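/- Let $G$ be a group with a finite symmetric generating set $\Sigma$. A knapsack expression over $\Sigma$ is a formal expression $e=u_1^{x_1}v_1u_2^{x_2}v_2\cdots u_k^{x_k}v_k$ with $k\ge 1$, words $u_i,v_i\in\Sigma^*$, all $u_i$ non-empty, and pairwise distinct variables $x_1,\dots,x_k$. Its degree is $\deg(e)=k$, its length is $\|e\|=\sum_{i=1}^k(|u_i|+|v_i|)$, and $\mathsf{sol}_G(e)\subseteq\mathbb{N}^k$ is the set of all $(n_1,\dots,n_k)\in\mathbb{N}^k$ with $u_1^{n_1}v_1\cdots u_k^{n_k}v_k=1$ in $G$. The group $G$ is knapsack-semilinear if $\mathsf{sol}_G(e)$ is semilinear for every knapsack expression $e$ over $\Sigma$. The magnitude $\mathsf{mag}(S)$ of a semilinear set $S\subseteq\mathbb{N}^k$ is the smallest $N$ such that $S=\bigcup_{i=1}^{p}(b_i+P_i\mathbb{N}^{k_i})$ for finitely many vectors $b_i\in\mathbb{N}^k$ and matrices $P_i\in\mathbb{N}^{k\times k_i}$ all of whose entries are at most $N$. For $m\le n$ let $\mathsf{K}_{G,\Sigma}(n,m)$ be the maximum of $\mathsf{mag}(\mathsf{sol}_G(e))$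 over all knapsack expressions $e$ over $\Sigma$ with $\mathsf{sol}_G(e)\neq\emptyset$, $\|e\|\le n$ and $\deg(e)\le m$ (and $0$ if there are none). **Theorem.** There is a constant $C$ such that the following holds for all knapsack-semilinear groups $G_1,G_2$ with finite symmetric generating sets $\Sigma_1,\Sigma_2$. Let $G=G_1*G_2$ be the free product, with generating set $\Sigma=\Sigma_1\cup\Sigma_2$, and let $\mathsf{K}(n,m)=\max\{\mathsf{K}_{G_1,\Sigma_1}(n,m),\mathsf{K}_{G_2,\Sigma_2}(n,m)\}$. Then $G$ is knapsack-semilinear, and for all $n,m\in\mathbb{N}$ with $m\le n$, $$\mathsf{K}_{G,\Sigma}(n,m)\le\max\{\mathsf{K}(6mn,m),\;C\,m\,n^4\}.$$ In particular, if $\mathsf{K}_{G_1,\Sigma_1}$ and $\mathsf{K}_{G_2,\Sigma_2}$ are bounded by polynomials (on the pairs $m\le n$), then so is $\mathsf{K}_{G,\Sigma}$. -/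

import Mathlib

namespace Knapsack

/-- The data `(b, P)` of a linear set: a base vector `b ∈ ℕ^d` and a matrix `P ∈ ℕ^{d × k}` whose
columns are the period vectors. -/
structure LinearRep (d : ℕ) where
  base : Fin d → ℕ
  numPeriods : ℕ
  periods : Matrix (Fin d) (Fin numPeriods) ℕ

/-- The linear set `L(b, P) = b + P · ℕ^k`. -/
def LinearRep.toSet {d : ℕ} (L : LinearRep d) : Set (Fin d → ℕ) :=
  {x | ∃ c : Fin L.numPeriods → ℕ, x = L.base + L.periods.mulVec c}

/-- `max {‖b‖, ‖P‖}`, the largest entry of `b` and `P`. -/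
def LinearRep.norm {d : ℕ} (L : LinearRep d) : ℕ :=
  max (Finset.univ.sup L.base)
    (Finset.univ.sup fun i => Finset.univ.sup fun j => L.periods i j)

/-- A semilinear representation `(b₁, P₁, …, b_k, P_k)`. The empty list represents the empty
set. -/
abbrev SemilinearRep (d : ℕ) := List (LinearRep d)

/-- The semilinear set `⋃ᵢ L(bᵢ, Pᵢ)`. -/
def SemilinearRep.toSet {d : ℕ} (R : SemilinearRep d) : Set (Fin d → ℕ) :=
  {x | ∃ L ∈ R, x ∈ L.toSet}

/-- The largest number that occurs in a semilinear representation. -/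
def SemilinearRep.norm {d : ℕ} (R : SemilinearRep d) : ℕ :=
  (R.map LinearRep.norm).foldr max 0

/-- The magnitude of a semilinear set: the smallest norm of a semilinear representation of it. -/
noncomputable def mag {d : ℕ} (S : Set (Fin d → ℕ)) : ℕ :=
  sInf {N | ∃ R : SemilinearRep d, SemilinearRep.toSet R = S ∧ SemilinearRep.norm R = N}

/-- A knapsack expression `u₁^{x₁} v₁ u₂^{x₂} v₂ ⋯ u_k^{x_k} v_k` over the alphabet `A`, with
`k ≥ 1`, words `uᵢ, vᵢ ∈ A^*` and all `uᵢ` nonempty. The variables of a knapsack expression are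
pairwise distinct, so they are indexed by their position. -/
structure Expr (A : Type*) where
  deg : ℕ
  deg_pos : 1 ≤ deg
  period : Fin deg → List A
  const : Fin deg → List A
  period_ne_nil : ∀ i, period i ≠ []

/-- The length `∑ᵢ (|uᵢ| + |vᵢ|)` of a knapsack expression. -/
def Expr.length {A : Type*} (e : Expr A) : ℕ :=
  ∑ i, ((e.period i).length + (e.const i).length)

/-- The word `u₁^{σ(x₁)} v₁ ⋯ u_k^{σ(x_k)} v_k`. -/
def Expr.valuate {A : Type*} (e : Expr A) (σ : Fin e.deg → ℕ) : List A :=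
  (List.ofFn fun i => (List.replicate (σ i) (e.period i)).flatten ++ e.const i).flatten

/-- The element of `G` to which a word over `S ⊆ G` evaluates. -/
def evalWord {G : Type*} [Group G] {S : Set G} (w : List S) : G :=
  (w.map fun a => (a : G)).prod

/-- The set of all `G`-solutions of `e = 1`, as a subset of `ℕ^k`. -/
def Expr.sol {G : Type*} [Group G] {S : Set G} (e : Expr S) : Set (Fin e.deg → ℕ) :=
  {σ | evalWord (e.valuate σ) = 1}

/-- `S` is a finite symmetric generating set of the group `G`. -/
structure IsFiniteSymmGenSet {G : Type*} [Group G] (S : Set G) : Prop where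
  finite : S.Finite
  inv_mem : ∀ a ∈ S, a⁻¹ ∈ S
  generates : ∀ g : G, ∃ w : List S, evalWord w = g

/-- Every knapsack expression over `S` has a semilinear solution set. -/
def IsKnapsackSemilinear {G : Type*} [Group G] (S : Set G) : Prop :=
  ∀ e : Expr S, IsSemilinearSet e.sol

/-- `Knap(n, m)`: the knapsack expressions over `S` that have a solution, length at most `n` and
degree at most `m`. -/
def Knap {G : Type*} [Group G] (S : Set G) (n m : ℕ) : Set (Expr S) :=
  {e | e.sol.Nonempty ∧ e.length ≤ n ∧ e.deg ≤ m}

/-- The function `K_{G,S}(n, m) = max {mag(sol(e)) | e ∈ Knap(n, m)}`, where the maximum over the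
empty set is `0`. For finite `S` the maximum is taken over a finite set (see `finite_knap`). -/
noncomputable def K {G : Type*} [Group G] (S : Set G) (n m : ℕ) : ℕ :=
  sSup {N | ∃ e ∈ Knap S n m, mag e.sol = N}

/-- The generating set `S₁ ∪ S₂` of the free product `G₁ * G₂`. -/
def freeProductGens {G₁ G₂ : Type*} [Group G₁] [Group G₂] (S₁ : Set G₁) (S₂ : Set G₂) :
    Set (Monoid.Coprod G₁ G₂) :=
  (Monoid.Coprod.inl '' S₁) ∪ (Monoid.Coprod.inr '' S₂)

/-- A function of pairs `m ≤ n` is bounded by a polynomial. Because of `m ≤ n`, it does not matter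
whether the polynomial is in `n` or in `n` and `m`. -/
def PolyBounded (f : ℕ → ℕ → ℕ) : Prop :=
  ∃ p : Polynomial ℕ, ∀ n m, m ≤ n → f n m ≤ p.eval n

theorem finite_knap {G : Type*} [Group G] {S : Set G} (hS : S.Finite) (n m : ℕ) :
    (Knap S n m).Finite := by
  have := hS.to_subtype
  have hW : {w : List S | w.length ≤ n}.Finite := List.finite_length_le S n
  have hF : ∀ k : ℕ, {f : Fin k → List S | ∀ i, f i ∈ {w : List S | w.length ≤ n}}.Finite :=
    fun k => Set.Finite.pi' fun _ => hW
  have hT : (⋃ k ∈ Set.Iic m,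
      (fun p : (Fin k → List S) × (Fin k → List S) =>
        (⟨k, p⟩ : Σ k : ℕ, (Fin k → List S) × (Fin k → List S))) ''
        ({f : Fin k → List S | ∀ i, f i ∈ {w : List S | w.length ≤ n}} ×ˢ
          {f : Fin k → List S | ∀ i, f i ∈ {w : List S | w.length ≤ n}})).Finite :=
    Set.Finite.biUnion (Set.finite_Iic m) fun k _ => ((hF k).prod (hF k)).image _
  refine Set.Finite.of_finite_image (f := fun e : Expr S =>
    (⟨e.deg, e.period, e.const⟩ : Σ k : ℕ, (Fin k → List S) × (Fin k → List S)))
    (hT.subset ?_) ?_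
  · rintro _ ⟨e, ⟨-, hl, hd⟩, rfl⟩
    have hle : ∀ i, (e.period i).length + (e.const i).length ≤ n := fun i =>
      le_trans (Finset.single_le_sum
        (f := fun i => (e.period i).length + (e.const i).length)
        (fun _ _ => Nat.zero_le _) (Finset.mem_univ i)) hl
    simp only [Set.mem_iUnion]
    exact ⟨e.deg, hd, (e.period, e.const),
      ⟨fun i => le_trans (Nat.le_add_right _ _) (hle i),
        fun i => le_trans (Nat.le_add_left _ _) (hle i)⟩, rfl⟩
  · rintro ⟨k, h, u, v, hu⟩ - ⟨k', h', u', v', hu'⟩ - heq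
    simp only [Sigma.mk.injEq] at heq
    obtain ⟨rfl, h2⟩ := heq
    have h3 := eq_of_heq h2
    simp only [Prod.mk.injEq] at h3
    obtain ⟨rfl, rfl⟩ := h3
    rfl

open scoped Pointwise in
theorem LinearRep.toSet_eq_vadd {d : ℕ} (L : LinearRep d) : L.toSet =
    L.base +ᵥ (AddSubmonoid.closure (Set.range fun j i => L.periods i j) : Set (Fin d → ℕ)) := by
  ext x
  simp only [LinearRep.toSet, Set.mem_ofPred_eq, Set.mem_vadd_set, SetLike.mem_coe,
    AddSubmonoid.mem_closure_range_iff_of_fintype, vadd_eq_add]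
  constructor
  · rintro ⟨c, rfl⟩
    refine ⟨_, ⟨c, rfl⟩, ?_⟩
    ext i
    simp [Matrix.mulVec, dotProduct, mul_comm]
  · rintro ⟨_, ⟨c, rfl⟩, rfl⟩
    refine ⟨c, ?_⟩
    ext i
    simp [Matrix.mulVec, dotProduct, mul_comm]

open scoped Pointwise in
/-- The semilinear sets are exactly the sets with a semilinear representation, so that `mag` is a
minimum over a nonempty set for them. -/
theorem isSemilinearSet_iff_exists_rep {d : ℕ} (S : Set (Fin d → ℕ)) :
    IsSemilinearSet S ↔ ∃ R : SemilinearRep d, SemilinearRep.toSet R = S := by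
  constructor
  · rintro ⟨T, hf, h, rfl⟩
    induction T, hf using Set.Finite.induction_on with
    | empty => exact ⟨[], by simp [SemilinearRep.toSet]⟩
    | @insert t T _ _ ih =>
      obtain ⟨R, hR⟩ := ih fun s hs => h s (Set.mem_insert_of_mem _ hs)
      obtain ⟨a, s, hs, rfl⟩ := h _ (Set.mem_insert _ _)
      obtain ⟨k, f, -, rfl⟩ := hs.fin_param
      refine ⟨⟨a, k, Matrix.of fun i j => f j i⟩ :: R, ?_⟩
      rw [Set.sUnion_insert, ← hR]
      have h1 := LinearRep.toSet_eq_vadd ⟨a, k, Matrix.of fun i j => f j i⟩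
      change _ = a +ᵥ (AddSubmonoid.closure (Set.range f) : Set (Fin d → ℕ)) at h1
      ext x
      simp only [SemilinearRep.toSet, List.mem_cons, exists_eq_or_imp, Set.mem_ofPred_eq,
        Set.mem_union, h1]
  · rintro ⟨R, rfl⟩
    refine ⟨LinearRep.toSet '' {L | L ∈ R}, (List.finite_toSet R).image _, ?_, ?_⟩
    · rintro _ ⟨L, -, rfl⟩
      exact ⟨L.base, _, Set.finite_range _, L.toSet_eq_vadd⟩
    · ext x
      simp [SemilinearRep.toSet]

end Knapsack

/-! Fix a solution `τ`. It is enough to find a linear set of solutions that contains `τ` and whose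
entries are bounded independently of `τ`: only finitely many such sets exist, and their union is the
whole solution set (`exists_rep_of_cert`). Such a linear set is a `Cert`.

Every base `u` is first written as `p c p⁻¹`, where `c` is a word over one factor or is cyclically
reduced with respect to the free product (`isSimpleConj_or_isCyclicConj`). The expression becomes a
product of items: syllables, which live in one factor and may contain variable powers, and powers of
cyclically reduced words, whose variables form the set `C`. A stack machine reads the items from
left to right, guided by `τ`, and keeps a stack whose expansion under `τ` is reduced. A syllable
whose value is `1` is split off as an equation in one factor; the function `K` of that factor
supplies its certificate, and its variables occur nowhere else. Once the input is exhausted, the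
stack expands to a reduced list with product `1`, which is empty by the normal form theorem, so the
powers left on it have exponent `0`.

The one source of unbounded exponents in `C` is the cancellation of a power `v ^ y` on the stack
against an incoming `s u ^ x`. By a Fine–Wilf type argument (`periodic_cancellation`), a
cancellation that swallows `s u ^ |v|` forces `v ^ |u| s u ^ |v| = s`. Then adding `|u|` to `y` and
`|v|` to `x` preserves the equation, so this vector serves as a period and can be subtracted from
`τ` (`Active.of_cpow`). After that only boundedly many copies of either power have to be unrolled.

The bounds come from two invariants. Base entries outside `C` come from factor certificates alone.
Base entries in `C` grow only when copies are unrolled, and each such step lowers a potential by at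
least the number of copies, so the initial potential, quadratic in the word length for each power,
bounds them. The parameter `w` bounds the weight of every stack item, and `w` plus the weight of the
unread input stays below `W`; this bounds the length of the factor equations. The two claims for
idle and active configurations are proved by simultaneous induction on the potential
(`idleGoal_and_activeGoal`). -/

namespace Knapsack

set_option linter.unusedSectionVars false

/-! ### Reduced lists of labelled elements of two subgroups -/

section Reduced

variable {G : Type*} [Group G]

/-- Alternating lists of nontrivial elements of two subgroups `H true` and `H false`. -/
def IsReduced (H : Bool → Subgroup G) (l : List (Bool × G)) : Prop :=
  l.IsChain (fun a b => a.1 ≠ b.1) ∧ ∀ a ∈ l, a.2 ∈ H a.1 ∧ a.2 ≠ 1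

/-- The product of a list of labelled elements. -/
def labelProd (l : List (Bool × G)) : G := (l.map Prod.snd).prod

@[simp] theorem labelProd_nil : labelProd ([] : List (Bool × G)) = 1 := rfl

@[simp] theorem labelProd_cons (a : Bool × G) (l : List (Bool × G)) :
    labelProd (a :: l) = a.2 * labelProd l := by simp [labelProd]

@[simp] theorem labelProd_append (l l' : List (Bool × G)) :
    labelProd (l ++ l') = labelProd l * labelProd l' := by simp [labelProd]

/-- Nonempty reduced lists have nontrivial products: the two subgroups generate their free
product. -/
def IsFreePair (H : Bool → Subgroup G) : Prop :=
  ∀ l : List (Bool × G), IsReduced H l → labelProd l = 1 → l = []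

variable {H : Bool → Subgroup G}

theorem isReduced_nil : IsReduced H [] := ⟨List.isChain_nil, by simp⟩

theorem isReduced_singleton {a : Bool × G} (h : a.2 ∈ H a.1) (h1 : a.2 ≠ 1) :
    IsReduced H [a] := ⟨List.isChain_singleton a, by simp [h, h1]⟩

theorem isReduced_append {l l' : List (Bool × G)} : IsReduced H (l ++ l') ↔
    IsReduced H l ∧ IsReduced H l' ∧ ∀ a ∈ l.getLast?, ∀ b ∈ l'.head?, a.1 ≠ b.1 := by
  simp only [IsReduced, List.isChain_append, List.mem_append]
  constructor
  · rintro ⟨⟨h1, h2, h3⟩, h4⟩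
    exact ⟨⟨h1, fun a ha => h4 a (.inl ha)⟩, ⟨h2, fun a ha => h4 a (.inr ha)⟩, h3⟩
  · rintro ⟨⟨h1, h4⟩, ⟨h2, h5⟩, h3⟩
    exact ⟨⟨h1, h2, h3⟩, fun a ha => ha.elim (h4 a) (h5 a)⟩

theorem IsReduced.left {l l' : List (Bool × G)} (h : IsReduced H (l ++ l')) : IsReduced H l :=
  (isReduced_append.1 h).1

theorem IsReduced.right {l l' : List (Bool × G)} (h : IsReduced H (l ++ l')) : IsReduced H l' :=
  (isReduced_append.1 h).2.1

theorem IsReduced.join {X Y : List (Bool × G)} {a b : Bool × G} (h : IsReduced H (X ++ [a]))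
    (h' : IsReduced H (b :: Y)) (hab : a.1 ≠ b.1) : IsReduced H (X ++ [a] ++ b :: Y) :=
  isReduced_append.2 ⟨h, h', by simpa using hab⟩

theorem IsReduced.merge {X Y : List (Bool × G)} {a b : Bool × G} (h : IsReduced H (X ++ [a]))
    (h' : IsReduced H (b :: Y)) (hab : a.1 = b.1) (h1 : a.2 * b.2 ≠ 1) :
    IsReduced H (X ++ [(a.1, a.2 * b.2)] ++ Y) := by
  obtain ⟨hX, ha, hXa⟩ := isReduced_append.1 h
  obtain ⟨hb, hY, hbY⟩ := isReduced_append.1 (show IsReduced H ([b] ++ Y) from h')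
  have hm : (a.2 * b.2) ∈ H a.1 :=
    mul_mem (ha.2 a (by simp)).1 (by rw [hab]; exact (hb.2 b (by simp)).1)
  refine isReduced_append.2 ⟨isReduced_append.2 ⟨hX, isReduced_singleton hm h1, ?_⟩, hY, ?_⟩
  · intro c hc d hd
    simp only [List.head?_cons, Option.mem_def, Option.some.injEq] at hd
    subst hd
    exact hXa c hc a (by simp)
  · intro c hc d hd
    simp only [List.getLast?_append, List.getLast?_singleton, Option.some_or, Option.mem_def,
      Option.some.injEq] at hc
    subst hc
    have := hbY b (by simp) d hd
    rwa [← hab] at this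

end Reduced

/-! ### Certificates: linear sets of solutions through a given solution -/

section Cert

variable {V : Type*}

/-- A certificate for the solution `τ` of the constraint `E` with variables in `X`: a linear set
`b + ⟨P⟩` of solutions that contains `τ`. Base entries are at most `μ` for variables in `C`, and at
most `κ` for the others; period entries are at most `ρ`. -/
def Cert (C : Set V) (κ ρ μ : ℕ) (X : Multiset V) (τ : V → ℕ) (E : (V → ℕ) → Prop) : Prop :=
  ∃ (b : V → ℕ) (P : Set (V → ℕ)),
    (∀ x, x ∉ X → b x = 0) ∧ (∀ p ∈ P, ∀ x, x ∉ X → p x = 0) ∧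
    (∀ x, x ∉ C → b x ≤ κ) ∧ (∀ x, x ∈ C → b x ≤ μ) ∧ (∀ p ∈ P, ∀ x, p x ≤ ρ) ∧
    (∃ p ∈ AddSubmonoid.closure P, ∀ x ∈ X, τ x = b x + p x) ∧
    ∀ y, ∀ p ∈ AddSubmonoid.closure P, (∀ x ∈ X, y x = b x + p x) → E y

variable {C : Set V} {κ ρ μ : ℕ} {X : Multiset V} {τ : V → ℕ} {E : (V → ℕ) → Prop}

theorem eq_zero_of_mem_closure {P : Set (V → ℕ)} {x : V} (h : ∀ p ∈ P, p x = 0) {p : V → ℕ}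
    (hp : p ∈ AddSubmonoid.closure P) : p x = 0 := by
  induction hp using AddSubmonoid.closure_induction with
  | mem p hp => exact h p hp
  | zero => rfl
  | add p q _ _ hp hq => simp [hp, hq]

theorem Cert.trivial (h : ∀ x ∈ X, τ x = 0) (hE : ∀ y, (∀ x ∈ X, y x = 0) → E y) :
    Cert C κ ρ μ X τ E := by
  refine ⟨0, ∅, by simp, by simp, by simp, by simp, by simp, ⟨0, zero_mem _, by simpa using h⟩, ?_⟩
  intro y p hp hy
  refine hE y fun x hx => ?_
  rw [hy x hx, eq_zero_of_mem_closure (x := x) (by simp) hp]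
  rfl

/-- Shift a certificate by `d`; variables that occur only in the new constraint are fixed. -/
theorem Cert.lift {μ' : ℕ} {X' : Multiset V} {τ' : V → ℕ} {E' : (V → ℕ) → Prop}
    (h : Cert C κ ρ μ' X' τ' E') (d : V → ℕ) (hX : ∀ x ∈ X', x ∈ X)
    (hdX : ∀ x, x ∉ X → d x = 0) (hdC : ∀ x, x ∉ C → d x = 0)
    (h1 : ∀ x ∈ X', τ x = τ' x + d x) (h2 : ∀ x ∈ X, x ∉ X' → τ x = d x)
    (hμ : ∀ x, μ' + d x ≤ μ)
    (hE : ∀ y, (∀ x ∈ X, x ∉ X' → y x = 0) → E' y → E (y + d)) :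
    Cert C κ ρ μ X τ E := by
  obtain ⟨b, P, hb, hP, hbC', hbC, hPρ, ⟨p, hp, hτ⟩, hsol⟩ := h
  refine ⟨b + d, P, ?_, fun p hp x hx => hP p hp x fun h => hx (hX x h), ?_, ?_, hPρ,
    ⟨p, hp, ?_⟩, ?_⟩
  · intro x hx
    simp [hb x fun h => hx (hX x h), hdX x hx]
  · intro x hx
    simpa [hdC x hx] using hbC' x hx
  · intro x hx
    have := hbC x hx
    have := hμ x
    simp only [Pi.add_apply]
    lia
  · intro x hx
    by_cases hx' : x ∈ X'
    · rw [h1 x hx', hτ x hx', Pi.add_apply]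
      lia
    · rw [h2 x hx hx', Pi.add_apply, hb x hx',
        eq_zero_of_mem_closure (fun q hq => hP q hq x hx') hp]
      lia
  · intro y q hq hy
    have hdy : ∀ x, d x ≤ y x := by
      intro x
      by_cases hx : x ∈ X
      · rw [hy x hx, Pi.add_apply]
        lia
      · rw [hdX x hx]
        exact Nat.zero_le _
    have hyd : y = (y - d) + d := by
      ext x
      have := hdy x
      simp only [Pi.add_apply, Pi.sub_apply]
      lia
    rw [hyd]
    refine hE _ (fun x hx hx' => ?_) (hsol _ q hq fun x hx => ?_)
    · rw [Pi.sub_apply, hy x hx, Pi.add_apply, hb x hx',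
        eq_zero_of_mem_closure (fun q hq => hP q hq x hx') hq]
      lia
    · rw [Pi.sub_apply, hy x (hX x hx), Pi.add_apply]
      lia

theorem Cert.congr {X' : Multiset V} {E' : (V → ℕ) → Prop} {μ' : ℕ}
    (h : Cert C κ ρ μ' X' τ E') (hX : ∀ x, x ∈ X' ↔ x ∈ X) (hμ : μ' ≤ μ) (hE : ∀ y, E' y → E y) :
    Cert C κ ρ μ X τ E :=
  h.lift 0 (fun x => (hX x).1) (by simp) (by simp) (by simp)
    (fun x hx hx' => (hx' ((hX x).2 hx)).elim) (fun _ => by simpa using hμ)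
    (fun y _ h => by simpa using hE y h)

/-- Add a period `d` that preserves the constraint. -/
theorem Cert.pump {τ' : V → ℕ} (h : Cert C κ ρ μ X τ' E) (d : V → ℕ)
    (hdX : ∀ x, x ∉ X → d x = 0) (hρ : ∀ x, d x ≤ ρ) (hτ : τ = τ' + d)
    (hE : ∀ y, E y → E (y + d)) : Cert C κ ρ μ X τ E := by
  obtain ⟨b, P, hb, hP, hbC', hbC, hPρ, ⟨p, hp, hτ'⟩, hsol⟩ := h
  refine ⟨b, insert d P, hb, ?_, hbC', hbC, ?_, ⟨p + d, ?_, ?_⟩, ?_⟩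
  · rintro p (rfl | hp)
    · exact hdX
    · exact hP p hp
  · rintro p (rfl | hp)
    · exact hρ
    · exact hPρ p hp
  · exact add_mem (AddSubmonoid.closure_mono (Set.subset_insert _ _) hp)
      (AddSubmonoid.subset_closure (Set.mem_insert _ _))
  · intro x hx
    rw [hτ, Pi.add_apply, hτ' x hx, Pi.add_apply, add_assoc]
  · intro y q hq hy
    rw [Set.insert_eq, AddSubmonoid.closure_union, AddSubmonoid.mem_sup] at hq
    obtain ⟨q1, hq1, q2, hq2, rfl⟩ := hq
    obtain ⟨n, rfl⟩ := AddSubmonoid.mem_closure_singleton.1 hq1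
    clear hq1
    -- The copies of `d` are peeled off one at a time. The truncated subtraction `y - d` is exact:
    -- on `X` at least one copy of `d` lies below `y`, and off `X` the vector `d` vanishes.
    induction n generalizing y with
    | zero => exact hsol y q2 hq2 (by simpa using hy)
    | succ n ih =>
      have hyd : y = (y - d) + d := by
        ext x
        by_cases hx : x ∈ X
        · have := hy x hx
          simp only [Pi.add_apply, Pi.sub_apply, Pi.smul_apply, smul_eq_mul, add_mul] at this ⊢
          lia
        · simp [hdX x hx]
      rw [hyd]
      refine hE _ (ih _ fun x hx => ?_)
      have := hy x hx
      simp only [Pi.add_apply, Pi.sub_apply, Pi.smul_apply, smul_eq_mul, add_mul] at this ⊢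
      lia

/-- Combine certificates for constraints with disjoint sets of variables. -/
theorem Cert.combine {X₁ X₂ : Multiset V} {E₁ E₂ : (V → ℕ) → Prop}
    (h₁ : Cert C κ ρ μ X₁ τ E₁) (h₂ : Cert C κ ρ 0 X₂ τ E₂)
    (hX : ∀ x, x ∈ X ↔ x ∈ X₁ ∨ x ∈ X₂) (hd : ∀ x ∈ X₁, x ∉ X₂)
    (hE : ∀ y, E₁ y → E₂ y → E y) : Cert C κ ρ μ X τ E := by
  obtain ⟨b, P, hb, hP, hbC', hbC, hPρ, ⟨p, hp, hτ⟩, hsol⟩ := h₁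
  obtain ⟨b₂, P₂, hb₂, hP₂, hbC'₂, hbC₂, hPρ₂, ⟨p₂, hp₂, hτ₂⟩, hsol₂⟩ := h₂
  have z : ∀ q ∈ AddSubmonoid.closure P, ∀ x ∈ X₂, q x = 0 := fun q hq x hx =>
    eq_zero_of_mem_closure (fun r hr => hP r hr x fun h => hd x h hx) hq
  have z₂ : ∀ q ∈ AddSubmonoid.closure P₂, ∀ x ∈ X₁, q x = 0 := fun q hq x hx =>
    eq_zero_of_mem_closure (fun r hr => hP₂ r hr x (hd x hx)) hq
  have zb : ∀ x ∈ X₂, b x = 0 := fun x hx => hb x fun h => hd x h hx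
  have zb₂ : ∀ x ∈ X₁, b₂ x = 0 := fun x hx => hb₂ x (hd x hx)
  refine ⟨b + b₂, P ∪ P₂, ?_, ?_, ?_, ?_, ?_, ⟨p + p₂, ?_, ?_⟩, ?_⟩
  · intro x hx
    rw [hX, not_or] at hx
    simp [hb x hx.1, hb₂ x hx.2]
  · rintro q (hq | hq) x hx <;> rw [hX, not_or] at hx
    · exact hP q hq x hx.1
    · exact hP₂ q hq x hx.2
  · intro x hx
    by_cases hx1 : x ∈ X₁
    · simpa [zb₂ x hx1] using hbC' x hx
    · simpa [hb x hx1] using hbC'₂ x hx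
  · intro x hx
    have := hbC₂ x hx
    simpa [Nat.le_zero.1 this] using hbC x hx
  · rintro q (hq | hq)
    · exact hPρ q hq
    · exact hPρ₂ q hq
  · rw [AddSubmonoid.closure_union, AddSubmonoid.mem_sup]
    exact ⟨p, hp, p₂, hp₂, rfl⟩
  · intro x hx
    rcases (hX x).1 hx with hx | hx
    · simp [hτ x hx, zb₂ x hx, z₂ p₂ hp₂ x hx]
    · simp [hτ₂ x hx, zb x hx, z p hp x hx]
  · intro y q hq hy
    rw [AddSubmonoid.closure_union, AddSubmonoid.mem_sup] at hq
    obtain ⟨q, hq, q₂, hq₂, rfl⟩ := hq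
    refine hE y (hsol y q hq fun x hx => ?_) (hsol₂ y q₂ hq₂ fun x hx => ?_)
    · simp [hy x ((hX x).2 (.inl hx)), zb₂ x hx, z₂ q₂ hq₂ x hx]
    · simp [hy x ((hX x).2 (.inr hx)), zb x hx, z q hq x hx]

end Cert

/-! ### Syllables, cyclically reduced powers, and stacks of them -/

section Items

variable {G : Type*} [Group G] {V : Type*}

/-- A factor of a syllable: a constant word, or a power of a word with a variable exponent. -/
abbrev Atom (V G : Type*) := Option V × List G

def Atom.eval (a : Atom V G) (y : V → ℕ) : G :=
  match a.1 with
  | none => a.2.prod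
  | some x => a.2.prod ^ y x

/-- The element of `G` described by a list of atoms. -/
def fragEval (F : List (Atom V G)) (y : V → ℕ) : G := (F.map fun a => a.eval y).prod

def fragVars (F : List (Atom V G)) : Multiset V := (F.filterMap Prod.fst : List V)

def fragLen (F : List (Atom V G)) : ℕ := (F.map fun a => a.2.length).sum

@[simp] theorem fragEval_append (F F' : List (Atom V G)) (y : V → ℕ) :
    fragEval (F ++ F') y = fragEval F y * fragEval F' y := by simp [fragEval]

@[simp] theorem fragVars_append (F F' : List (Atom V G)) :
    fragVars (F ++ F') = fragVars F + fragVars F' := by simp [fragVars]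

@[simp] theorem fragLen_append (F F' : List (Atom V G)) :
    fragLen (F ++ F') = fragLen F + fragLen F' := by simp [fragLen]

@[simp] theorem fragEval_const (w : List G) (y : V → ℕ) :
    fragEval [((none, w) : Atom V G)] y = w.prod := by simp [fragEval, Atom.eval]

@[simp] theorem fragVars_const (w : List G) : fragVars [((none, w) : Atom V G)] = 0 := by
  simp [fragVars]

@[simp] theorem fragLen_const (w : List G) : fragLen [((none, w) : Atom V G)] = w.length := by
  simp [fragLen]

theorem fragEval_congr {F : List (Atom V G)} {y y' : V → ℕ} (h : ∀ x ∈ fragVars F, y x = y' x) :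
    fragEval F y = fragEval F y' := by
  induction F with
  | nil => rfl
  | cons a F ih =>
    obtain ⟨o, w⟩ := a
    have ih := ih fun x hx => h x (by
      have : fragVars ((o, w) :: F) = fragVars [(o, w)] + fragVars F := fragVars_append [_] F
      rw [this]
      exact Multiset.mem_add.2 (.inr hx))
    have e : ∀ y : V → ℕ, fragEval ((o, w) :: F) y = fragEval [(o, w)] y * fragEval F y :=
      fragEval_append [_] F
    rw [e, e, ih]
    congr 1
    cases o with
    | none => simp
    | some x => simp [fragEval, Atom.eval, h x (by simp [fragVars])]

/-- A letter: a nonempty constant word over one of the two alphabets. -/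
abbrev Letter (G : Type*) := Bool × List G

def Letter.val (l : Letter G) : Bool × G := (l.1, l.2.prod)

/-- The element of `G` described by a list of letters. -/
def lettersEval (s : List (Letter G)) : G := labelProd (s.map Letter.val)

def lettersLen (s : List (Letter G)) : ℕ := (s.map fun l => l.2.length).sum

@[simp] theorem lettersEval_nil : lettersEval ([] : List (Letter G)) = 1 := rfl

@[simp] theorem lettersEval_cons (l : Letter G) (s : List (Letter G)) :
    lettersEval (l :: s) = l.2.prod * lettersEval s := by simp [lettersEval, Letter.val]

@[simp] theorem lettersEval_append (s t : List (Letter G)) :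
    lettersEval (s ++ t) = lettersEval s * lettersEval t := by simp [lettersEval]

/-- The concatenation of `n` copies of `u`. -/
def repeatList {α : Type*} (u : List α) (n : ℕ) : List α := (List.replicate n u).flatten

@[simp] theorem repeatList_zero {α : Type*} (u : List α) : repeatList u 0 = [] := rfl

theorem repeatList_succ {α : Type*} (u : List α) (n : ℕ) :
    repeatList u (n + 1) = u ++ repeatList u n := by
  simp [repeatList, List.replicate_succ]

theorem repeatList_add {α : Type*} (u : List α) (m n : ℕ) :
    repeatList u (m + n) = repeatList u m ++ repeatList u n := by
  rw [repeatList, List.replicate_add, List.flatten_append]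
  rfl

@[simp] theorem length_repeatList {α : Type*} (u : List α) (n : ℕ) :
    (repeatList u n).length = n * u.length := by
  simp [repeatList]

theorem map_repeatList {α β : Type*} (f : α → β) (u : List α) (n : ℕ) :
    (repeatList u n).map f = repeatList (u.map f) n := by
  simp [repeatList]

theorem mem_of_mem_repeatList {α : Type*} {u : List α} {n : ℕ} {a : α}
    (h : a ∈ repeatList u n) : a ∈ u := by
  simp only [repeatList, List.mem_flatten, List.mem_replicate] at h
  obtain ⟨l, ⟨-, rfl⟩, h⟩ := h
  exact h

@[simp] theorem lettersEval_repeatList (u : List (Letter G)) (n : ℕ) :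
    lettersEval (repeatList u n) = lettersEval u ^ n := by
  induction n with
  | zero => simp
  | succ n ih => rw [repeatList_succ, lettersEval_append, ih, pow_succ']

/-- The items of the stack machine: syllables, and powers of cyclically reduced elements. -/
inductive Item (V G : Type*)
  | syl (j : Bool) (F : List (Atom V G))
  | cpow (x : V) (u : List (Letter G))

namespace Item

def eval : Item V G → (V → ℕ) → G
  | syl _ F, y => fragEval F y
  | cpow x u, y => lettersEval u ^ y x

def vars : Item V G → Multiset V
  | syl _ F => fragVars F
  | cpow x _ => {x}

/-- Counts generators rather than letters, and ignores the exponent. This is the quantity that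
becomes the length of a knapsack expression over a factor. -/
def wt : Item V G → ℕ
  | syl _ F => fragLen F
  | cpow _ u => lettersLen u

/-- A syllable contributes one entry even when its value is trivial. Hence an empty expansion
excludes syllables, and a reduced expansion makes all of them nontrivial. -/
def expand : Item V G → (V → ℕ) → List (Bool × G)
  | syl j F, y => [(j, fragEval F y)]
  | cpow x u, y => repeatList (u.map Letter.val) (y x)

/-- The contribution of a stack item to the potential. -/
def stackPot (N : ℕ) : Item V G → ℕ
  | syl _ _ => 2
  | cpow _ _ => 4 * N ^ 2 + 2 * N + 1

/-- The contribution of an input item to the potential. -/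
def inputPot (N : ℕ) : Item V G → ℕ
  | syl _ _ => 2 * N + 4
  | cpow _ _ => 10 * N ^ 2 + 6 * N + 7

/-- Well-formed items: syllables are over the alphabet `S j` with variables outside `C`, powers
have a variable in `C` and a cyclically reduced base of at most `N` letters. -/
def OK (H : Bool → Subgroup G) (S : Bool → Set G) (C : Set V) (N : ℕ) : Item V G → Prop
  | syl j F => ∀ a ∈ F, (∀ g ∈ a.2, g ∈ S j) ∧ ∀ x, a.1 = some x → x ∉ C ∧ a.2 ≠ []
  | cpow x u => x ∈ C ∧ u ≠ [] ∧ u.length ≤ N ∧ (∀ l ∈ u, ∀ g ∈ l.2, g ∈ S l.1) ∧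
      ∀ n, IsReduced H (repeatList (u.map Letter.val) n)

end Item

/-- The syllable given by a letter. -/
def Letter.toItem (l : Letter G) : Item V G := .syl l.1 [(none, l.2)]

/-- The value of a stack, the head of the list being the rightmost item. -/
def stackEval (st : List (Item V G)) (y : V → ℕ) : G := (st.reverse.map fun i => i.eval y).prod

def inputEval (inp : List (Item V G)) (y : V → ℕ) : G := (inp.map fun i => i.eval y).prod

def itemsVars (st : List (Item V G)) : Multiset V := (st.map Item.vars).sum

def stackExpand (st : List (Item V G)) (y : V → ℕ) : List (Bool × G) :=
  (st.reverse.map fun i => i.expand y).flatten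

def stackPot (N : ℕ) (st : List (Item V G)) : ℕ := (st.map (Item.stackPot N)).sum

def inputPot (N : ℕ) (st : List (Item V G)) : ℕ := (st.map (Item.inputPot N)).sum

def inputWt (inp : List (Item V G)) : ℕ := (inp.map Item.wt).sum

@[simp] theorem stackEval_nil (y : V → ℕ) : stackEval ([] : List (Item V G)) y = 1 := rfl
@[simp] theorem inputEval_nil (y : V → ℕ) : inputEval ([] : List (Item V G)) y = 1 := rfl
@[simp] theorem itemsVars_nil : itemsVars ([] : List (Item V G)) = 0 := rfl
@[simp] theorem stackExpand_nil (y : V → ℕ) : stackExpand ([] : List (Item V G)) y = [] := rfl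
@[simp] theorem stackPot_nil (N : ℕ) : stackPot N ([] : List (Item V G)) = 0 := rfl
@[simp] theorem inputPot_nil (N : ℕ) : inputPot N ([] : List (Item V G)) = 0 := rfl
@[simp] theorem inputWt_nil : inputWt ([] : List (Item V G)) = 0 := rfl

@[simp] theorem stackEval_cons (i : Item V G) (st : List (Item V G)) (y : V → ℕ) :
    stackEval (i :: st) y = stackEval st y * i.eval y := by simp [stackEval]
@[simp] theorem inputEval_cons (i : Item V G) (st : List (Item V G)) (y : V → ℕ) :
    inputEval (i :: st) y = i.eval y * inputEval st y := by simp [inputEval]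
@[simp] theorem itemsVars_cons (i : Item V G) (st : List (Item V G)) :
    itemsVars (i :: st) = i.vars + itemsVars st := by simp [itemsVars]
@[simp] theorem stackExpand_cons (i : Item V G) (st : List (Item V G)) (y : V → ℕ) :
    stackExpand (i :: st) y = stackExpand st y ++ i.expand y := by simp [stackExpand]
@[simp] theorem stackPot_cons (N : ℕ) (i : Item V G) (st : List (Item V G)) :
    stackPot N (i :: st) = i.stackPot N + stackPot N st := by simp [stackPot]
@[simp] theorem inputPot_cons (N : ℕ) (i : Item V G) (st : List (Item V G)) :
    inputPot N (i :: st) = i.inputPot N + inputPot N st := by simp [inputPot]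
@[simp] theorem inputWt_cons (i : Item V G) (st : List (Item V G)) :
    inputWt (i :: st) = i.wt + inputWt st := by simp [inputWt]

@[simp] theorem stackEval_append (s t : List (Item V G)) (y : V → ℕ) :
    stackEval (s ++ t) y = stackEval t y * stackEval s y := by simp [stackEval]
@[simp] theorem inputEval_append (s t : List (Item V G)) (y : V → ℕ) :
    inputEval (s ++ t) y = inputEval s y * inputEval t y := by simp [inputEval]
@[simp] theorem itemsVars_append (s t : List (Item V G)) :
    itemsVars (s ++ t) = itemsVars s + itemsVars t := by simp [itemsVars]
@[simp] theorem stackExpand_append (s t : List (Item V G)) (y : V → ℕ) :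
    stackExpand (s ++ t) y = stackExpand t y ++ stackExpand s y := by simp [stackExpand]
@[simp] theorem stackPot_append (N : ℕ) (s t : List (Item V G)) :
    stackPot N (s ++ t) = stackPot N s + stackPot N t := by simp [stackPot]
@[simp] theorem inputPot_append (N : ℕ) (s t : List (Item V G)) :
    inputPot N (s ++ t) = inputPot N s + inputPot N t := by simp [inputPot]
@[simp] theorem inputWt_append (s t : List (Item V G)) :
    inputWt (s ++ t) = inputWt s + inputWt t := by simp [inputWt]

@[simp] theorem eval_toItem (l : Letter G) (y : V → ℕ) : (l.toItem : Item V G).eval y = l.2.prod := by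
  simp [Letter.toItem, Item.eval]
@[simp] theorem vars_toItem (l : Letter G) : (l.toItem : Item V G).vars = 0 := by
  simp [Letter.toItem, Item.vars]
@[simp] theorem wt_toItem (l : Letter G) : (l.toItem : Item V G).wt = l.2.length := by
  simp [Letter.toItem, Item.wt]
@[simp] theorem expand_toItem (l : Letter G) (y : V → ℕ) :
    (l.toItem : Item V G).expand y = [l.val] := by
  simp [Letter.toItem, Item.expand, Letter.val]
@[simp] theorem stackPot_toItem (N : ℕ) (l : Letter G) : (l.toItem : Item V G).stackPot N = 2 := rfl
@[simp] theorem inputPot_toItem (N : ℕ) (l : Letter G) :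
    (l.toItem : Item V G).inputPot N = 2 * N + 4 := rfl

@[simp] theorem stackEval_toItem (s : List (Letter G)) (y : V → ℕ) :
    stackEval (s.map Letter.toItem) y = lettersEval s.reverse := by
  induction s with
  | nil => simp
  | cons l s ih => simp [ih]
@[simp] theorem itemsVars_toItem (s : List (Letter G)) :
    itemsVars (s.map Letter.toItem : List (Item V G)) = 0 := by
  induction s with
  | nil => simp
  | cons l s ih => simp [ih]
@[simp] theorem stackExpand_toItem (s : List (Letter G)) (y : V → ℕ) :
    stackExpand (s.map Letter.toItem) y = (s.map Letter.val).reverse := by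
  induction s with
  | nil => simp
  | cons l s ih => simp [ih]
@[simp] theorem stackPot_map_toItem (N : ℕ) (s : List (Letter G)) :
    stackPot N (s.map Letter.toItem : List (Item V G)) = 2 * s.length := by
  induction s with
  | nil => simp
  | cons l s ih => simp [ih]; lia

theorem Item.eval_congr {i : Item V G} {y y' : V → ℕ} (h : ∀ x ∈ i.vars, y x = y' x) :
    i.eval y = i.eval y' := by
  cases i with
  | syl j F => exact fragEval_congr h
  | cpow x u => simp [Item.eval, h x (by simp [Item.vars])]

theorem Item.expand_congr {i : Item V G} {y y' : V → ℕ} (h : ∀ x ∈ i.vars, y x = y' x) :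
    i.expand y = i.expand y' := by
  cases i with
  | syl j F => simp [Item.expand, fragEval_congr h]
  | cpow x u => simp [Item.expand, h x (by simp [Item.vars])]

theorem stackExpand_congr {st : List (Item V G)} {y y' : V → ℕ}
    (h : ∀ x ∈ itemsVars st, y x = y' x) : stackExpand st y = stackExpand st y' := by
  induction st with
  | nil => rfl
  | cons i st ih =>
    simp only [itemsVars_cons, Multiset.mem_add] at h
    simp [ih fun x hx => h x (.inr hx), Item.expand_congr fun x hx => h x (.inl hx)]

theorem stackEval_congr {st : List (Item V G)} {y y' : V → ℕ}
    (h : ∀ x ∈ itemsVars st, y x = y' x) : stackEval st y = stackEval st y' := by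
  induction st with
  | nil => rfl
  | cons i st ih =>
    simp only [itemsVars_cons, Multiset.mem_add] at h
    simp [ih fun x hx => h x (.inr hx), Item.eval_congr fun x hx => h x (.inl hx)]

theorem inputEval_congr {st : List (Item V G)} {y y' : V → ℕ}
    (h : ∀ x ∈ itemsVars st, y x = y' x) : inputEval st y = inputEval st y' := by
  induction st with
  | nil => rfl
  | cons i st ih =>
    simp only [itemsVars_cons, Multiset.mem_add] at h
    simp [ih fun x hx => h x (.inr hx), Item.eval_congr fun x hx => h x (.inl hx)]

theorem labelProd_expand (i : Item V G) (y : V → ℕ) : labelProd (i.expand y) = i.eval y := by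
  cases i with
  | syl j F => simp [Item.expand, Item.eval]
  | cpow x u =>
    rw [Item.expand, Item.eval, ← map_repeatList, ← lettersEval_repeatList]
    rfl

theorem labelProd_stackExpand (st : List (Item V G)) (y : V → ℕ) :
    labelProd (stackExpand st y) = stackEval st y := by
  induction st with
  | nil => rfl
  | cons i st ih => simp [ih, labelProd_expand]

/-- The result of cancelling the top-first list `A` of letters against the list `B`. -/
theorem exists_cancellation (A B : List (Letter G)) :
    (∃ Γ A', A = Γ ++ A' ∧ List.Forall₂ (fun p q : Letter G => p.2.prod * q.2.prod = 1) Γ B) ∨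
    (∃ Γ p A' Δ q B', A = Γ ++ p :: A' ∧ B = Δ ++ q :: B' ∧
      List.Forall₂ (fun p q : Letter G => p.2.prod * q.2.prod = 1) Γ Δ ∧
      (p.1 ≠ q.1 ∨ p.1 = q.1 ∧ p.2.prod * q.2.prod ≠ 1)) ∨
    A.length < B.length := by
  induction B generalizing A with
  | nil => exact .inl ⟨[], A, by simp⟩
  | cons q B ih =>
    cases A with
    | nil => exact .inr (.inr (by simp))
    | cons p A =>
      by_cases h : p.1 = q.1
      · by_cases h1 : p.2.prod * q.2.prod = 1
        · rcases ih A with ⟨Γ, A', rfl, h2⟩ | ⟨Γ, p', A', Δ, q', B', rfl, rfl, h2, h3⟩ | h2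
          · exact .inl ⟨p :: Γ, A', rfl, .cons h1 h2⟩
          · exact .inr (.inl ⟨p :: Γ, p', A', q :: Δ, q', B', rfl, rfl, .cons h1 h2, h3⟩)
          · exact .inr (.inr (by simpa using h2))
        · exact .inr (.inl ⟨[], p, A, [], q, B, rfl, rfl, .nil, .inr ⟨h, h1⟩⟩)
      · exact .inr (.inl ⟨[], p, A, [], q, B, rfl, rfl, .nil, .inl h⟩)

/-- Cancellation proceeds from the inside out: the heads of `A` and `B` are adjacent in the product,
since `A` is listed from the top of the stack. -/
theorem lettersEval_of_forall₂ {A B : List (Letter G)}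
    (h : List.Forall₂ (fun p q : Letter G => p.2.prod * q.2.prod = 1) A B) :
    lettersEval A.reverse * lettersEval B = 1 := by
  induction h with
  | nil => simp
  | @cons p q A B h _ ih =>
    simp only [List.reverse_cons, lettersEval_append, lettersEval_cons, lettersEval_nil, mul_one]
    calc _ = lettersEval A.reverse * (p.2.prod * q.2.prod) * lettersEval B := by group
      _ = 1 := by rw [h, mul_one, ih]

variable {H : Bool → Subgroup G} {S : Bool → Set G} {C : Set V} {N : ℕ}

theorem Item.OK.append {j : Bool} {F F' : List (Atom V G)} (h : (Item.syl j F).OK H S C N)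
    (h' : (Item.syl j F').OK H S C N) : (Item.syl j (F ++ F')).OK H S C N := by
  intro a ha
  rcases List.mem_append.1 ha with ha | ha
  · exact h a ha
  · exact h' a ha

theorem Letter.ok_toItem {l : Letter G} (h : ∀ g ∈ l.2, g ∈ S l.1) :
    (l.toItem : Item V G).OK H S C N := by
  intro a ha
  simp only [List.mem_singleton] at ha
  subst ha
  exact ⟨h, by simp⟩

theorem length_le_lettersLen {u : List (Letter G)} {l : Letter G} (h : l ∈ u) :
    l.2.length ≤ lettersLen u :=
  List.single_le_sum (by simp) _ (List.mem_map.2 ⟨l, h, rfl⟩)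

end Items

/-! ### The stack machine and the induction on its potential -/

section Machine

variable {G : Type*} [Group G] {V : Type*} [DecidableEq V]

/-- The data on which the stack machine runs. Syllables of length at most `W` with value `1` have
certificates. -/
structure Machine (H : Bool → Subgroup G) (S : Bool → Set G) (C : Set V) (N W κ ρ : ℕ) :
    Prop where
  free : IsFreePair H
  subset : ∀ j, ∀ g ∈ S j, g ∈ H j
  le_rho : N ≤ ρ
  block : ∀ (j : Bool) (F : List (Atom V G)) (τ : V → ℕ), (Item.syl j F).OK H S C N →
    fragLen F ≤ W → (fragVars F).Nodup → fragEval F τ = 1 →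
    Cert C κ ρ 0 (fragVars F) τ fun y => fragEval F y = 1

/-- Configurations in which no power is being pushed. -/
structure Idle (H : Bool → Subgroup G) (S : Bool → Set G) (C : Set V) (N W : ℕ)
    (st inp : List (Item V G)) (w : ℕ) (τ : V → ℕ) : Prop where
  ok : ∀ i ∈ st, i.OK H S C N ∧ i.wt ≤ w
  red : IsReduced H (stackExpand st τ)
  inp_ok : ∀ i ∈ inp, i.OK H S C N
  wt_le : w + inputWt inp ≤ W
  nodup : (itemsVars st + itemsVars inp).Nodup
  sol : stackEval st τ * inputEval inp τ = 1

/-- Configurations in which the remainder `s · u ^ x` of a power is being pushed. -/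
structure Active (H : Bool → Subgroup G) (S : Bool → Set G) (C : Set V) (N W : ℕ)
    (st : List (Item V G)) (s : List (Letter G)) (x : V) (u : List (Letter G))
    (inp : List (Item V G)) (w : ℕ) (τ : V → ℕ) : Prop where
  ok : ∀ i ∈ st, i.OK H S C N ∧ i.wt ≤ w
  red : IsReduced H (stackExpand st τ)
  cp : (Item.cpow x u).OK H S C N
  s_len : s.length ≤ N
  s_ok : ∀ l ∈ s, (∀ g ∈ l.2, g ∈ S l.1) ∧ l.2.length ≤ lettersLen u
  s_red : ∀ n, IsReduced H (s.map Letter.val ++ repeatList (u.map Letter.val) n)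
  inp_ok : ∀ i ∈ inp, i.OK H S C N
  wt_le : w + lettersLen u + inputWt inp ≤ W
  nodup : (itemsVars st + ({x} + itemsVars inp)).Nodup
  sol : stackEval st τ * (lettersEval s * lettersEval u ^ τ x * inputEval inp τ) = 1

variable (H : Bool → Subgroup G) (S : Bool → Set G) (C : Set V) (N W κ ρ : ℕ)

/-- Idle configurations of potential at most `μ` have certificates. -/
def IdleGoal (μ : ℕ) : Prop :=
  ∀ st inp w τ, Idle H S C N W st inp w τ → stackPot N st + inputPot N inp ≤ μ →
    Cert C κ ρ μ (itemsVars st + itemsVars inp) τ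
      fun y => stackEval st y * inputEval inp y = 1

/-- Active configurations of potential at most `μ` have certificates. -/
def ActiveGoal (μ : ℕ) : Prop :=
  ∀ st s x u inp w τ, Active H S C N W st s x u inp w τ →
    stackPot N st + (10 * N ^ 2 + 6 * N + 5) + (if s = [] then 1 else 0) + inputPot N inp ≤ μ →
    Cert C κ ρ μ (itemsVars st + ({x} + itemsVars inp)) τ
      fun y => stackEval st y * (lettersEval s * lettersEval u ^ y x * inputEval inp y) = 1

variable {H S C N W κ ρ}

theorem fragEval_mem (hM : Machine H S C N W κ ρ) {j : Bool} {F : List (Atom V G)}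
    (h : (Item.syl j F).OK H S C N) (y : V → ℕ) : fragEval F y ∈ H j := by
  refine Subgroup.list_prod_mem _ fun g hg => ?_
  simp only [List.mem_map] at hg
  obtain ⟨⟨o, w⟩, ha, rfl⟩ := hg
  have hw : w.prod ∈ H j :=
    Subgroup.list_prod_mem _ fun g hg => hM.subset j g ((h _ ha).1 g hg)
  cases o with
  | none => exact hw
  | some x => exact pow_mem hw _

/-- Remove a syllable with trivial value. -/
theorem Cert.emit (hM : Machine H S C N W κ ρ) {μ : ℕ} {X X' : Multiset V} {τ : V → ℕ}
    {E E' : (V → ℕ) → Prop} {j : Bool} {F : List (Atom V G)} (h : Cert C κ ρ μ X' τ E')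
    (hF : (Item.syl j F).OK H S C N) (hW : fragLen F ≤ W) (h1 : fragEval F τ = 1)
    (hX : X = X' + fragVars F) (hn : X.Nodup) (hE : ∀ y, E' y → fragEval F y = 1 → E y) :
    Cert C κ ρ μ X τ E := by
  subst hX
  rw [Multiset.nodup_add] at hn
  exact h.combine (hM.block j F τ hF hW hn.2.1 h1) (by simp)
    (fun x hx hx' => Multiset.disjoint_left.1 hn.2.2 hx hx') hE

/-- With no power on top, a syllable interacts with at most one stack item: it is trivial and split
off, or it lands on a different label, or it merges with the top syllable, and then the merged
syllable is split off or kept. -/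
theorem Idle.push_top (hM : Machine H S C N W κ ρ) {ν : ℕ} (hI : IdleGoal H S C N W κ ρ ν)
    {st inp : List (Item V G)} {j : Bool} {F : List (Atom V G)} {w : ℕ} {τ : V → ℕ}
    (h : Idle H S C N W st (.syl j F :: inp) w τ) (hμ : stackPot N st + 2 + inputPot N inp ≤ ν)
    (htop : ∀ i ∈ st.head?, ∀ x u, i ≠ .cpow x u) :
    Cert C κ ρ ν (itemsVars st + itemsVars (.syl j F :: inp)) τ
      fun y => stackEval st y * inputEval (.syl j F :: inp) y = 1 := by
  obtain ⟨hok, hred, hinp, hwt, hnd, hsol⟩ := h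
  have hF := hinp _ List.mem_cons_self
  have hinp' : ∀ i ∈ inp, i.OK H S C N := fun i hi => hinp i (List.mem_cons_of_mem _ hi)
  have hfH := fragEval_mem hM hF τ
  simp only [inputWt_cons, Item.wt, itemsVars_cons, Item.vars, inputEval_cons, Item.eval] at *
  have hpush : fragEval F τ ≠ 1 → IsReduced H (stackExpand st τ ++ [(j, fragEval F τ)]) →
      Cert C κ ρ ν (itemsVars st + (fragVars F + itemsVars inp)) τ
        fun y => stackEval st y * (fragEval F y * inputEval inp y) = 1 := by
    intro h1 hr
    refine (hI (.syl j F :: st) inp (w + fragLen F) τ ⟨?_, ?_, hinp', by lia, ?_, ?_⟩ ?_).congr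
      ?_ le_rfl ?_
    · intro i hi
      rcases List.mem_cons.1 hi with rfl | hi
      · exact ⟨hF, Nat.le_add_left _ _⟩
      · exact ⟨(hok i hi).1, (hok i hi).2.trans (Nat.le_add_right _ _)⟩
    · simpa [Item.expand] using hr
    · simpa [Item.vars, add_comm, add_left_comm, add_assoc] using hnd
    · simpa [Item.eval, mul_assoc] using hsol
    · simp only [stackPot_cons, Item.stackPot]
      lia
    · intro x
      simp only [itemsVars_cons, Item.vars, Multiset.mem_add]
      tauto
    · intro y hy
      simpa [Item.eval, mul_assoc] using hy
  by_cases h1 : fragEval F τ = 1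
  · refine Cert.emit hM (hI st inp w τ ⟨hok, hred, hinp', by lia, ?_, ?_⟩ ?_) hF (by lia) h1 ?_ hnd ?_
    · rw [add_left_comm] at hnd
      exact (Multiset.nodup_add.1 hnd).2.1
    · simpa [h1] using hsol
    · lia
    · abel
    · intro y hy hy'
      simpa [hy'] using hy
  rcases st with _ | ⟨⟨j', F'⟩ | ⟨x, u⟩, st⟩
  · exact hpush h1 (isReduced_singleton hfH h1)
  · simp only [stackExpand_cons, Item.expand] at hred
    by_cases hj : j' = j
    · subst hj
      have hF' := (hok _ List.mem_cons_self)
      simp only [stackPot_cons, Item.stackPot, itemsVars_cons, stackEval_cons, Item.vars,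
        Item.eval] at *
      have hst : ∀ i ∈ st, i.OK H S C N ∧ i.wt ≤ w := fun i hi => hok i (List.mem_cons_of_mem _ hi)
      by_cases h2 : fragEval F' τ * fragEval F τ = 1
      · refine Cert.emit hM (F := F' ++ F) (hI st inp w τ ⟨hst, hred.left, hinp', by lia, ?_, ?_⟩ ?_)
          (hF'.1.append hF) ?_ (by simpa using h2) ?_ hnd ?_
        · have e : fragVars F' + itemsVars st + (fragVars F + itemsVars inp) =
            fragVars F' + fragVars F + (itemsVars st + itemsVars inp) := by abel
          rw [e] at hnd
          exact (Multiset.nodup_add.1 hnd).2.1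
        · rw [← hsol, mul_assoc, ← mul_assoc (fragEval F' τ), h2, one_mul]
        · lia
        · simp only [fragLen_append]
          lia
        · rw [fragVars_append]
          abel
        · intro y hy hy'
          rw [fragEval_append] at hy'
          rw [mul_assoc, ← mul_assoc (fragEval F' y), hy', one_mul, hy]
      -- The merged syllable may weigh up to `w + fragLen F`, which becomes the new bound on stack
      -- items; the input has become lighter by exactly `fragLen F`.
      · refine (hI (.syl j' (F' ++ F) :: st) inp (w + fragLen F) τ
          ⟨?_, ?_, hinp', by lia, ?_, ?_⟩ ?_).congr ?_ le_rfl ?_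
        · intro i hi
          rcases List.mem_cons.1 hi with rfl | hi
          · exact ⟨hF'.1.append hF, by simpa [Item.wt] using hF'.2⟩
          · exact ⟨(hst i hi).1, (hst i hi).2.trans (Nat.le_add_right _ _)⟩
        · simpa [Item.expand] using
            hred.merge (Y := []) (b := (j', fragEval F τ)) (isReduced_singleton hfH h1) rfl h2
        · simpa [Item.vars, add_comm, add_left_comm, add_assoc] using hnd
        · simpa [Item.eval, mul_assoc] using hsol
        · simp only [stackPot_cons, Item.stackPot]
          lia
        · intro x
          simp only [itemsVars_cons, Item.vars, Multiset.mem_add, fragVars_append]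
          tauto
        · intro y hy
          simpa [Item.eval, mul_assoc] using hy
    · refine hpush h1 ?_
      simp only [stackExpand_cons, Item.expand]
      exact hred.join (isReduced_singleton hfH h1) hj
  · exact (htop _ rfl x u rfl).elim

/-- Syllables never expand to nothing, and a power has a nonempty base, so only powers with exponent
`0` remain. -/
theorem eq_zero_of_stackExpand_eq_nil {st : List (Item V G)} {τ : V → ℕ}
    (hok : ∀ i ∈ st, i.OK H S C N) (h : stackExpand st τ = []) : ∀ x ∈ itemsVars st, τ x = 0 := by
  induction st with
  | nil => simp
  | cons i st ih =>
    rw [stackExpand_cons, List.append_eq_nil_iff] at h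
    intro x hx
    rw [itemsVars_cons, Multiset.mem_add] at hx
    rcases hx with hx | hx
    · cases i with
      | syl j F => simp [Item.expand] at h
      | cpow y u =>
        have hu := (hok _ List.mem_cons_self).2.1
        simp only [Item.vars, Multiset.mem_singleton] at hx
        subst hx
        have := congrArg List.length h.2
        simp only [Item.expand, length_repeatList, List.length_map, List.length_nil,
          mul_eq_zero, List.length_eq_zero_iff] at this
        tauto
    · exact ih (fun i hi => hok i (List.mem_cons_of_mem _ hi)) h.1 x hx

theorem stackExpand_add_single {st : List (Item V G)} {x : V} (hx : x ∉ itemsVars st)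
    (τ : V → ℕ) (n : ℕ) : stackExpand st (τ + Pi.single x n) = stackExpand st τ := by
  refine stackExpand_congr fun z hz => ?_
  have : z ≠ x := fun h => hx (h ▸ hz)
  simp [this]

theorem stackEval_add_single {st : List (Item V G)} {x : V} (hx : x ∉ itemsVars st)
    (τ : V → ℕ) (n : ℕ) : stackEval st (τ + Pi.single x n) = stackEval st τ := by
  refine stackEval_congr fun z hz => ?_
  have : z ≠ x := fun h => hx (h ▸ hz)
  simp [this]

theorem inputEval_add_single {st : List (Item V G)} {x : V} (hx : x ∉ itemsVars st)
    (τ : V → ℕ) (n : ℕ) : inputEval st (τ + Pi.single x n) = inputEval st τ := by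
  refine inputEval_congr fun z hz => ?_
  have : z ≠ x := fun h => hx (h ▸ hz)
  simp [this]

theorem exists_eq_add_single {τ : V → ℕ} {x : V} {n : ℕ} (h : n ≤ τ x) :
    ∃ τ' : V → ℕ, τ = τ' + Pi.single x n :=
  ⟨τ - Pi.single x n, by
    ext z
    by_cases hz : z = x
    · subst hz
      simp [h]
    · simp [hz]⟩

theorem ok_letters {u : List (Letter G)} {w : ℕ}
    (h : ∀ l ∈ u, (∀ g ∈ l.2, g ∈ S l.1) ∧ l.2.length ≤ w) :
    ∀ i ∈ (u.map Letter.toItem : List (Item V G)), i.OK H S C N ∧ i.wt ≤ w := by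
  intro i hi
  obtain ⟨l, hl, rfl⟩ := List.mem_map.1 hi
  exact ⟨Letter.ok_toItem (h l hl).1, by simpa using (h l hl).2⟩

theorem Item.OK.letters {x : V} {u : List (Letter G)} {w : ℕ} (h : (Item.cpow x u).OK H S C N)
    (hw : lettersLen u ≤ w) : ∀ l ∈ u, (∀ g ∈ l.2, g ∈ S l.1) ∧ l.2.length ≤ w :=
  fun l hl => ⟨h.2.2.2.1 l hl, (length_le_lettersLen hl).trans hw⟩

theorem stackExpand_reverse_toItem (s : List (Letter G)) (y : V → ℕ) :
    stackExpand (s.reverse.map Letter.toItem) y = s.map Letter.val := by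
  rw [stackExpand_toItem, List.map_reverse, List.reverse_reverse]

theorem notMem_of_nodup {x : V} {A B : Multiset V} (h : ({x} + (A + B)).Nodup) :
    x ∉ A ∧ x ∉ B := by
  have hx := Multiset.disjoint_left.1 (Multiset.nodup_add.1 h).2.2 (Multiset.mem_singleton_self x)
  rwa [Multiset.mem_add, not_or] at hx

/-- Split off `a` copies from a power on the top of the stack. -/
theorem Idle.unroll {x : V} {u : List (Letter G)} {st inp : List (Item V G)} {w a : ℕ} {τ : V → ℕ}
    (h : Idle H S C N W (.cpow x u :: st) inp w (τ + Pi.single x a)) :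
    Idle H S C N W ((repeatList u a).reverse.map Letter.toItem ++ .cpow x u :: st) inp w τ := by
  obtain ⟨hok, hred, hinp, hwt, hnd, hsol⟩ := h
  have hx : x ∉ itemsVars st ∧ x ∉ itemsVars inp := by
    rw [itemsVars_cons, add_assoc] at hnd
    exact notMem_of_nodup hnd
  have hcp := hok _ List.mem_cons_self
  refine ⟨?_, ?_, hinp, hwt, by simpa [-List.map_reverse] using hnd, ?_⟩
  · intro i hi
    rcases List.mem_append.1 hi with hi | hi
    · refine ok_letters (fun l hl => ?_) i hi
      exact hcp.1.letters hcp.2 l (mem_of_mem_repeatList (List.mem_reverse.1 hl))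
    · exact hok i hi
  · rw [stackExpand_cons, stackExpand_add_single hx.1] at hred
    rw [stackExpand_append, stackExpand_reverse_toItem, stackExpand_cons, map_repeatList]
    simpa [Item.expand, repeatList_add] using hred
  · rw [stackEval_cons, stackEval_add_single hx.1, inputEval_add_single hx.2] at hsol
    simpa [Item.eval, pow_add, mul_assoc, -List.map_reverse] using hsol

/-- The only obstacle to pushing a syllable is a power on top of the stack. Unrolling one copy of it
exposes a letter, and that suffices because a syllable meets only one letter. -/
theorem idleGoal_of_lt (hM : Machine H S C N W κ ρ) {μ : ℕ}
    (hI : ∀ ν < μ, IdleGoal H S C N W κ ρ ν) (hA : ∀ ν < μ, ActiveGoal H S C N W κ ρ ν) :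
    IdleGoal H S C N W κ ρ μ := by
  intro st inp w τ h hμ
  rcases inp with _ | ⟨⟨j, F⟩ | ⟨x, u⟩, inp⟩
  -- End of the run: the expansion of the stack is reduced with product `1`, hence empty by
  -- freeness, and the zero assignment on the remaining variables is the certificate.
  · obtain ⟨hok, hred, -, -, -, hsol⟩ := h
    simp only [inputEval_nil, mul_one, itemsVars_nil, add_zero] at *
    rw [← labelProd_stackExpand] at hsol
    have hnil := hM.free _ hred hsol
    have hz := eq_zero_of_stackExpand_eq_nil (fun i hi => (hok i hi).1) hnil
    refine Cert.trivial hz fun y hy => ?_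
    rw [← labelProd_stackExpand, stackExpand_congr (y' := τ) fun x hx => (hy x hx).trans
      (hz x hx).symm, hnil, labelProd_nil]
  · rcases st with _ | ⟨⟨j', F'⟩ | ⟨x, u⟩, st⟩
    · refine h.push_top hM (hI (μ - 1) ?_) ?_ (by simp) |>.congr (by simp) (Nat.sub_le _ _)
        fun y hy => hy
      all_goals
        simp only [inputPot_cons, Item.inputPot] at hμ
        lia
    · refine h.push_top hM (hI (μ - 1) ?_) ?_ (by simp) |>.congr (by simp) (Nat.sub_le _ _)
        fun y hy => hy
      all_goals
        simp only [inputPot_cons, Item.inputPot] at hμ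
        lia
    · have hcp := (h.ok _ List.mem_cons_self).1
      simp only [inputPot_cons, stackPot_cons, Item.inputPot, Item.stackPot] at hμ
      by_cases hτ : τ x = 0
      · have hnd := h.nodup
        rw [itemsVars_cons, add_assoc] at hnd
        refine (hI (μ - 1) (by lia) st (.syl j F :: inp) w τ ⟨fun i hi => h.ok i
          (List.mem_cons_of_mem _ hi), ?_, h.inp_ok, h.wt_le, (Multiset.nodup_add.1 hnd).2.1, ?_⟩
          ?_).lift 0 ?_ (by simp) (by simp) (by simp) ?_ (by simp) ?_
        · simpa [Item.expand, hτ] using h.red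
        · simpa [Item.eval, hτ] using h.sol
        · simp only [inputPot_cons, Item.inputPot]
          lia
        · intro z hz
          rw [itemsVars_cons, add_assoc]
          exact Multiset.mem_add.2 (.inr hz)
        · intro z hz hz'
          rw [itemsVars_cons, add_assoc, Multiset.mem_add] at hz
          simp only [Item.vars, Multiset.mem_singleton, hz', or_false] at hz
          simpa [hz] using hτ
        · intro y hy hE
          rw [itemsVars_cons, add_assoc] at hy
          have hx : x ∉ itemsVars st + itemsVars (.syl j F :: inp) := fun hx =>
            Multiset.disjoint_left.1 (Multiset.nodup_add.1 hnd).2.2 (by simp [Item.vars]) hx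
          have hyx := hy x (by simp [Item.vars]) hx
          simpa [Item.eval, hyx] using hE
      -- The `2 * N + 4` held by the input syllable pays for at most `N` new stack letters at `2`
      -- each, for the syllable itself at `2`, and for the shift of `x` by `1`.
      · obtain ⟨τ, rfl⟩ := exists_eq_add_single (x := x) (n := 1) (Nat.one_le_iff_ne_zero.2 hτ)
        have h' := h.unroll
        have hu := hcp.2.1
        have hx : x ∉ itemsVars st ∧ x ∉ itemsVars (.syl j F :: inp) := by
          have hnd := h.nodup
          rw [itemsVars_cons, add_assoc] at hnd
          exact notMem_of_nodup hnd
        refine (h'.push_top hM (hI (μ - 1) (by lia)) ?_ ?_).lift (Pi.single x 1) ?_ ?_ ?_ ?_ ?_ ?_ ?_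
        · simp only [stackPot_append, stackPot_map_toItem, List.length_reverse, length_repeatList,
            stackPot_cons, Item.stackPot]
          have := hcp.2.2.1
          lia
        · intro i hi y v
          rw [repeatList_succ, repeatList_zero, List.append_nil, List.head?_append_of_ne_nil] at hi
          · have := List.mem_of_mem_head? hi
            obtain ⟨l, -, rfl⟩ := List.mem_map.1 this
            simp [Letter.toItem]
          · simpa using hu
        · simp [-List.map_reverse]
        · intro z hz
          have : z ≠ x := by
            rintro rfl
            simp [Item.vars] at hz
          simp [this]
        · intro z hz
          have : z ≠ x := by
            rintro rfl
            exact hz hcp.1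
          simp [this]
        · simp
        · intro z hz hz'
          exact (hz' (by simpa [-List.map_reverse] using hz)).elim
        · intro z
          by_cases hz : z = x
          · subst hz
            simp only [Pi.single_eq_same]
            lia
          · simp [hz]
        · intro y _ hy
          rw [stackEval_cons, stackEval_add_single hx.1, inputEval_add_single hx.2]
          simpa [Item.eval, pow_add, mul_assoc, -List.map_reverse] using hy
  · obtain ⟨hok, hred, hinp, hwt, hnd, hsol⟩ := h
    have hcp := hinp _ List.mem_cons_self
    simp only [inputPot_cons, Item.inputPot, inputWt_cons, Item.wt] at hμ hwt
    refine (hA (μ - 1) (by lia) st [] x u inp w τ ⟨hok, hred, hcp, by simp, by simp, ?_,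
      fun i hi => hinp i (List.mem_cons_of_mem _ hi), by lia, ?_, ?_⟩ ?_).congr ?_
      (Nat.sub_le _ _) ?_
    · simpa using hcp.2.2.2.2
    · simpa [Item.vars] using hnd
    · simpa [Item.eval] using hsol
    · simp only [if_true]
      lia
    · simp [Item.vars]
    · intro y hy
      simpa [Item.eval] using hy

/-- Push the rest of a power when nothing cancels. -/
theorem push_power {ν : ℕ} (hI : IdleGoal H S C N W κ ρ ν) {st inp : List (Item V G)}
    {s u : List (Letter G)} {x : V} {w : ℕ} {τ : V → ℕ}
    (hok : ∀ i ∈ st, i.OK H S C N ∧ i.wt ≤ w)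
    (hs : ∀ l ∈ s, (∀ g ∈ l.2, g ∈ S l.1) ∧ l.2.length ≤ w)
    (hcp : (Item.cpow x u).OK H S C N) (hu : lettersLen u ≤ w)
    (hred : IsReduced H (stackExpand st τ ++
      (s.map Letter.val ++ repeatList (u.map Letter.val) (τ x))))
    (hinp : ∀ i ∈ inp, i.OK H S C N) (hwt : w + inputWt inp ≤ W)
    (hnd : (itemsVars st + ({x} + itemsVars inp)).Nodup)
    (hsol : stackEval st τ * (lettersEval s * lettersEval u ^ τ x * inputEval inp τ) = 1)
    (hμ : stackPot N st + 2 * s.length + (4 * N ^ 2 + 2 * N + 1) + inputPot N inp ≤ ν) :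
    Cert C κ ρ ν (itemsVars st + ({x} + itemsVars inp)) τ
      fun y => stackEval st y * (lettersEval s * lettersEval u ^ y x * inputEval inp y) = 1 := by
  refine (hI (.cpow x u :: (s.reverse.map Letter.toItem ++ st)) inp w τ
    ⟨?_, ?_, hinp, hwt, ?_, ?_⟩ ?_).congr ?_ le_rfl ?_
  · intro i hi
    rcases List.mem_cons.1 hi with rfl | hi
    · exact ⟨hcp, hu⟩
    rcases List.mem_append.1 hi with hi | hi
    · exact ok_letters (fun l hl => hs l (List.mem_reverse.1 hl)) i hi
    · exact hok i hi
  · rw [stackExpand_cons, stackExpand_append, stackExpand_reverse_toItem, List.append_assoc]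
    exact hred
  · simpa [Item.vars, -List.map_reverse, add_comm, add_left_comm, add_assoc] using hnd
  · simpa [Item.eval, mul_assoc, -List.map_reverse] using hsol
  · simp only [stackPot_cons, stackPot_append, stackPot_map_toItem, List.length_reverse,
      Item.stackPot]
    lia
  · intro z
    simp only [itemsVars_cons, itemsVars_append, itemsVars_toItem, Item.vars, Multiset.mem_add,
      zero_add]
    tauto
  · intro y hy
    simpa [Item.eval, mul_assoc, -List.map_reverse] using hy

theorem Active.notMem {st inp : List (Item V G)} {s u : List (Letter G)} {x : V} {w : ℕ}
    {τ : V → ℕ} (h : Active H S C N W st s x u inp w τ) :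
    x ∉ itemsVars st ∧ x ∉ itemsVars inp := by
  have := h.nodup
  rw [add_left_comm] at this
  exact notMem_of_nodup this

/-- On an empty stack nothing can cancel, and `s · u ^ x` is reduced by assumption, so it is pushed
as it stands. -/
theorem Active.of_nil {μ : ℕ} (hI : ∀ ν < μ, IdleGoal H S C N W κ ρ ν)
    {s u : List (Letter G)} {inp : List (Item V G)} {x : V} {w : ℕ} {τ : V → ℕ}
    (h : Active H S C N W [] s x u inp w τ)
    (hμ : stackPot N ([] : List (Item V G)) + (10 * N ^ 2 + 6 * N + 5) + (if s = [] then 1 else 0) +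
      inputPot N inp ≤ μ) :
    Cert C κ ρ μ (itemsVars ([] : List (Item V G)) + ({x} + itemsVars inp)) τ
      fun y => stackEval ([] : List (Item V G)) y * (lettersEval s * lettersEval u ^ y x * inputEval inp y) = 1 := by
  have := h.s_len
  refine (push_power (hI (μ - 1) (by lia)) (w := w + lettersLen u)
    (fun i hi => ⟨(h.ok i hi).1, (h.ok i hi).2.trans (Nat.le_add_right _ _)⟩)
    (fun l hl => ⟨(h.s_ok l hl).1, (h.s_ok l hl).2.trans (Nat.le_add_left _ _)⟩) h.cp
    (Nat.le_add_left _ _) (by simpa using h.s_red (τ x)) h.inp_ok h.wt_le h.nodup h.sol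
    ?_).congr (fun _ => Iff.rfl) (Nat.sub_le _ _) (fun _ hy => hy)
  simp only [stackPot_nil] at *
  lia

/-- Either the exponent is `0` and the power disappears, or one copy of `u` is moved into the
remainder. The extra `1` that an active configuration holds while its remainder is empty pays for
the shift of `x`. -/
theorem Active.of_syl_nil {μ : ℕ} (hI : ∀ ν < μ, IdleGoal H S C N W κ ρ ν)
    (hA : ∀ ν < μ, ActiveGoal H S C N W κ ρ ν)
    {st : List (Item V G)} {u : List (Letter G)} {inp : List (Item V G)} {x : V} {w : ℕ} {τ : V → ℕ}
    (h : Active H S C N W st [] x u inp w τ)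
    (hμ : stackPot N st + (10 * N ^ 2 + 6 * N + 5) + 1 + inputPot N inp ≤ μ) :
    Cert C κ ρ μ (itemsVars st + ({x} + itemsVars inp)) τ
      fun y => stackEval st y * (lettersEval [] * lettersEval u ^ y x * inputEval inp y) = 1 := by
  have hx := h.notMem
  have hxC := h.cp.1
  obtain ⟨hok, hred, hcp, -, -, -, hinp, hwt, hnd, hsol⟩ := h
  by_cases hτ : τ x = 0
  · refine (hI (μ - 1) (by lia) st inp w τ ⟨hok, hred, hinp, by lia, ?_, by simpa [hτ] using hsol⟩
      (by lia)).lift 0 ?_ (by simp) (by simp) (by simp) ?_ (by simp) ?_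
    · rw [add_left_comm] at hnd
      exact (Multiset.nodup_add.1 hnd).2.1
    · intro z hz
      simp only [Multiset.mem_add] at *
      tauto
    · intro z hz hz'
      simp only [Multiset.mem_add, Multiset.mem_singleton] at hz hz'
      obtain rfl : z = x := by tauto
      simpa using hτ
    · intro y hy hE
      have := hy x (by simp) (by simp [hx])
      simpa [this] using hE
  · obtain ⟨τ, rfl⟩ := exists_eq_add_single (x := x) (n := 1) (Nat.one_le_iff_ne_zero.2 hτ)
    refine (hA (μ - 1) (by lia) st u x u inp w τ ⟨hok, ?_, hcp, hcp.2.2.1, hcp.letters le_rfl, ?_,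
      hinp, hwt, hnd, ?_⟩ ?_).lift (Pi.single x 1) (fun _ => id) ?_ ?_ ?_ ?_ ?_ ?_
    · rwa [stackExpand_add_single hx.1] at hred
    · intro n
      rw [← repeatList_succ]
      exact hcp.2.2.2.2 _
    · rw [stackEval_add_single hx.1, inputEval_add_single hx.2] at hsol
      simpa [pow_succ'] using hsol
    · rw [if_neg hcp.2.1]
      lia
    · intro z hz
      have : z ≠ x := by
        rintro rfl
        simp at hz
      simp [this]
    · intro z hz
      have : z ≠ x := by
        rintro rfl
        exact hz hxC
      simp [this]
    · simp
    · intro z hz hz'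
      exact (hz' hz).elim
    · intro z
      by_cases hz : z = x
      · subst hz
        simp only [Pi.single_eq_same]
        lia
      · simp [hz]
    · intro y _ hy
      rw [stackEval_add_single hx.1, inputEval_add_single hx.2]
      simpa [pow_succ'] using hy

/-- The first letter of the remainder meets the top syllable. If they cancel, the syllable is split
off and its `2` units of potential also cover the `1` needed when the remainder becomes empty.
Otherwise the junction is reduced, possibly after merging, and the rest of the power goes onto the
stack. -/
theorem Active.of_syl_cons (hM : Machine H S C N W κ ρ) {μ : ℕ}
    (hI : ∀ ν < μ, IdleGoal H S C N W κ ρ ν) (hA : ∀ ν < μ, ActiveGoal H S C N W κ ρ ν)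
    {j : Bool} {F : List (Atom V G)} {st : List (Item V G)} {q : Letter G} {s u : List (Letter G)}
    {inp : List (Item V G)} {x : V} {w : ℕ} {τ : V → ℕ}
    (h : Active H S C N W (.syl j F :: st) (q :: s) x u inp w τ)
    (hμ : stackPot N (.syl j F :: st) + (10 * N ^ 2 + 6 * N + 5) + inputPot N inp ≤ μ) :
    Cert C κ ρ μ (itemsVars (.syl j F :: st) + ({x} + itemsVars inp)) τ
      fun y => stackEval (.syl j F :: st) y *
        (lettersEval (q :: s) * lettersEval u ^ y x * inputEval inp y) = 1 := by
  obtain ⟨hok, hred, hcp, hsl, hs, hsr, hinp, hwt, hnd, hsol⟩ := h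
  have hF := hok _ List.mem_cons_self
  have hq := hs _ List.mem_cons_self
  have hst : ∀ i ∈ st, i.OK H S C N ∧ i.wt ≤ w := fun i hi => hok i (List.mem_cons_of_mem _ hi)
  have hs' : ∀ l ∈ s, (∀ g ∈ l.2, g ∈ S l.1) ∧ l.2.length ≤ lettersLen u :=
    fun l hl => hs l (List.mem_cons_of_mem _ hl)
  have hqF : (Item.syl q.1 [((none, q.2) : Atom V G)]).OK H S C N := Letter.ok_toItem hq.1
  simp only [stackPot_cons, Item.stackPot, List.length_cons, List.map_cons, Item.wt] at *
  have hex : stackExpand (.syl j F :: st) τ = stackExpand st τ ++ [(j, fragEval F τ)] := by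
    simp [Item.expand]
  by_cases hj : j = q.1
  · subst hj
    by_cases h2 : fragEval F τ * q.2.prod = 1
    · refine (Cert.emit (μ := μ - 1) hM (F := F ++ [(none, q.2)]) (hA (μ - 1) (by lia) st s x u inp w τ
        ⟨hst, ?_, hcp, by lia, hs', fun n => IsReduced.right (l := [q.val]) (hsr n), hinp, hwt,
        ?_, ?_⟩ ?_) (hF.1.append hqF) ?_ (by simpa using h2) ?_ hnd ?_).congr
        (fun _ => Iff.rfl) (Nat.sub_le _ _) fun y hy => hy
      · rw [hex] at hred
        exact hred.left
      · rw [itemsVars_cons, add_assoc] at hnd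
        exact (Multiset.nodup_add.1 hnd).2.1
      · rw [← hsol]
        simp only [stackEval_cons, Item.eval, lettersEval_cons]
        calc _ = stackEval st τ * (fragEval F τ * q.2.prod) *
            (lettersEval s * lettersEval u ^ τ x * inputEval inp τ) := by rw [h2, mul_one]
          _ = _ := by group
      · split <;> lia
      · simp only [fragLen_append, fragLen_const]
        lia
      · simp only [itemsVars_cons, Item.vars, fragVars_append, fragVars_const]
        abel
      · intro y hy hy'
        rw [fragEval_append, fragEval_const] at hy'
        simp only [stackEval_cons, Item.eval, lettersEval_cons]
        rw [← hy]
        calc _ = stackEval st y * (fragEval F y * q.2.prod) *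
            (lettersEval s * lettersEval u ^ y x * inputEval inp y) := by group
          _ = _ := by rw [hy', mul_one]
    · refine (push_power (hI (μ - 1) (by lia)) (w := w + lettersLen u)
        (st := .syl q.1 (F ++ [(none, q.2)]) :: st) (s := s) (x := x) (u := u) (inp := inp) (τ := τ)
        ?_ (fun l hl => ⟨(hs' l hl).1, (hs' l hl).2.trans (Nat.le_add_left _ _)⟩) hcp
        (Nat.le_add_left _ _) ?_ hinp hwt ?_ ?_ ?_).congr ?_ (Nat.sub_le _ _) ?_
      · intro i hi
        rcases List.mem_cons.1 hi with rfl | hi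
        · refine ⟨hF.1.append hqF, ?_⟩
          simp only [Item.wt, fragLen_append, fragLen_const]
          lia
        · exact ⟨(hst i hi).1, (hst i hi).2.trans (Nat.le_add_right _ _)⟩
      · rw [hex] at hred
        simpa [Item.expand, Letter.val] using hred.merge (hsr (τ x)) rfl h2
      · simpa [Item.vars] using hnd
      · simpa [Item.eval, mul_assoc] using hsol
      · simp only [stackPot_cons, Item.stackPot]
        lia
      · simp [Item.vars]
      · intro y hy
        simpa [Item.eval, mul_assoc] using hy
  · refine (push_power (hI (μ - 1) (by lia)) (w := w + lettersLen u)
        (st := .syl j F :: st) (s := q :: s) (x := x) (u := u) (inp := inp) (τ := τ)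
        (fun i hi => ⟨(hok i hi).1, (hok i hi).2.trans (Nat.le_add_right _ _)⟩)
        (fun l hl => ⟨(hs l hl).1, (hs l hl).2.trans (Nat.le_add_left _ _)⟩) hcp
        (Nat.le_add_left _ _) ?_ hinp hwt hnd hsol ?_).congr (fun _ => Iff.rfl) (Nat.sub_le _ _)
        fun y hy => hy
    · rw [hex] at hred ⊢
      exact hred.join (hsr (τ x)) hj
    · simp only [stackPot_cons, Item.stackPot, List.length_cons]
      lia

/-- Two periodic words that cancel for long enough cancel forever. -/
theorem periodic_cancellation {u v s Γ A' : List (Letter G)} (hv : v ≠ [])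
    (hA : (repeatList v (u.length + s.length)).reverse = Γ ++ A')
    (h : List.Forall₂ (fun p q : Letter G => p.2.prod * q.2.prod = 1) Γ
      (s ++ repeatList u v.length)) :
    lettersEval v ^ u.length * (lettersEval s * lettersEval u ^ v.length) = lettersEval s := by
  have hlen := h.length_eq
  rw [List.length_append, length_repeatList] at hlen
  have hv1 : 1 ≤ v.length := List.length_pos_iff.2 hv
  -- The same periodic list is split in two ways. Comparing them shows that `Γ` consists of `|u|`
  -- reversed copies of `v` followed by its own prefix of length `|s|`. That prefix cancels `s`,
  -- which gives the claimed identity.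
  have e1 : (repeatList v s.length).reverse ++ (repeatList v u.length).reverse = Γ ++ A' := by
    rw [← List.reverse_append, ← repeatList_add, hA]
  have e2 : (repeatList v u.length).reverse ++ (repeatList v s.length).reverse = Γ ++ A' := by
    rw [← List.reverse_append, ← repeatList_add, add_comm, hA]
  have hs : s.length ≤ ((repeatList v s.length).reverse).length := by
    simpa using Nat.le_mul_of_pos_right _ hv1
  have t1 : Γ.take s.length = (repeatList v s.length).reverse.take s.length := by
    have := congrArg (List.take s.length) e1
    rw [List.take_append_of_le_length hs, List.take_append_of_le_length (by lia)] at this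
    exact this.symm
  have t2 : Γ = (repeatList v u.length).reverse ++ Γ.take s.length := by
    have := congrArg (List.take Γ.length) e2
    have hl : Γ.length = ((repeatList v u.length).reverse).length + s.length := by
      rw [hlen, List.length_reverse, length_repeatList]
      ring
    rw [List.take_append_of_le_length (le_refl _), List.take_length, hl,
      List.take_length_add_append] at this
    rw [t1]
    exact this.symm
  have p1 := lettersEval_of_forall₂ (List.forall₂_take_append Γ s _ h)
  have p2 := lettersEval_of_forall₂ h
  rw [t2, List.reverse_append, List.reverse_reverse, lettersEval_append, lettersEval_append,
    lettersEval_repeatList, lettersEval_repeatList, eq_inv_of_mul_eq_one_left p1] at p2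
  rw [← mul_right_inj (lettersEval s)⁻¹, inv_mul_cancel, ← p2]
  group

/-- Raising the two exponents inserts copies of `v` and `u` around `s` only, as neither variable
occurs elsewhere. All cancellation between the two powers is read off from the middle factor. -/
theorem active_eval_shift {st inp : List (Item V G)} {s u v : List (Letter G)} {x y : V}
    (hxy : y ≠ x) (hxs : x ∉ itemsVars st) (hys : y ∉ itemsVars st) (hxi : x ∉ itemsVars inp)
    (hyi : y ∉ itemsVars inp) (t : V → ℕ) (a b : ℕ) :
    stackEval (.cpow y v :: st) (t + Pi.single y a + Pi.single x b) *
      (lettersEval s * lettersEval u ^ (t + Pi.single y a + Pi.single x b : V → ℕ) x *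
        inputEval inp (t + Pi.single y a + Pi.single x b)) =
    stackEval st t * lettersEval v ^ t y * (lettersEval v ^ a * (lettersEval s * lettersEval u ^ b)) *
      (lettersEval u ^ t x * inputEval inp t) := by
  rw [stackEval_cons, stackEval_add_single hxs, stackEval_add_single hys,
    inputEval_add_single hxi, inputEval_add_single hyi]
  have h1 : (t + Pi.single y a + Pi.single x b : V → ℕ) y = t y + a := by simp [hxy]
  have h2 : (t + Pi.single y a + Pi.single x b : V → ℕ) x = b + t x := by
    simp [hxy.symm, add_comm]
  rw [Item.eval, h1, h2, pow_add, pow_add]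
  simp only [mul_assoc]

theorem stackExpand_shift {st : List (Item V G)} {v : List (Letter G)} {x y : V}
    (hxy : y ≠ x) (hxs : x ∉ itemsVars st) (hys : y ∉ itemsVars st) (t : V → ℕ) (a b : ℕ) :
    stackExpand (.cpow y v :: st) (t + Pi.single y a + Pi.single x b) =
      stackExpand (.cpow y v :: st) t ++ (repeatList v a).map Letter.val := by
  have h1 : (t + Pi.single y a + Pi.single x b : V → ℕ) y = t y + a := by simp [hxy]
  rw [stackExpand_cons, stackExpand_add_single hxs, stackExpand_add_single hys, stackExpand_cons,
    Item.expand, Item.expand, h1, repeatList_add, map_repeatList, List.append_assoc]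

theorem Active.notMem_top {st inp : List (Item V G)} {s u v : List (Letter G)} {x y : V} {w : ℕ}
    {τ : V → ℕ} (h : Active H S C N W (.cpow y v :: st) s x u inp w τ) :
    y ≠ x ∧ x ∉ itemsVars st ∧ y ∉ itemsVars st ∧ x ∉ itemsVars inp ∧ y ∉ itemsVars inp := by
  have h1 := h.notMem
  have h2 := h.nodup
  rw [itemsVars_cons, add_assoc] at h2
  have h2 := notMem_of_nodup h2
  simp only [itemsVars_cons, Item.vars, Multiset.mem_add, Multiset.mem_singleton, not_or] at h1 h2
  exact ⟨h2.2.1, h1.1.2, h2.1, h1.2, h2.2.2⟩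

/-- Completely unroll a power with a small exponent on the top of the stack. -/
theorem Active.of_cpow_small {μ : ℕ} (hA : ∀ ν < μ, ActiveGoal H S C N W κ ρ ν)
    {st inp : List (Item V G)} {s u v : List (Letter G)} {x y : V} {w : ℕ} {τ : V → ℕ}
    (h : Active H S C N W (.cpow y v :: st) s x u inp w τ) (hy : τ y ≤ u.length + s.length)
    (hμ : stackPot N (.cpow y v :: st) + (10 * N ^ 2 + 6 * N + 5) + (if s = [] then 1 else 0) +
      inputPot N inp ≤ μ) :
    Cert C κ ρ μ (itemsVars (.cpow y v :: st) + ({x} + itemsVars inp)) τ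
      fun t => stackEval (.cpow y v :: st) t *
        (lettersEval s * lettersEval u ^ t x * inputEval inp t) = 1 := by
  obtain ⟨hxy, hxs, hys, hxi, hyi⟩ := h.notMem_top
  obtain ⟨hok, hred, hcp, hsl, hs, hsr, hinp, hwt, hnd, hsol⟩ := h
  have hv := hok _ List.mem_cons_self
  have hyC := hv.1.1
  have hul := hcp.2.2.1
  have hvl := hv.1.2.2.1
  -- The at most `2 * N ^ 2` new letters cost `4 * N ^ 2`. The other `2 * N + 1` units of the
  -- power's stack potential pay for the shift of `y` by at most `2 * N`.
  have hlen : τ y * v.length ≤ 2 * N ^ 2 := by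
    calc τ y * v.length ≤ (N + N) * N := Nat.mul_le_mul (by lia) hvl
      _ = 2 * N ^ 2 := by ring
  simp only [stackPot_cons, Item.stackPot] at hμ
  set X' := itemsVars st + ({x} + itemsVars inp)
  have hX : itemsVars (.cpow y v :: st) + ({x} + itemsVars inp) = {y} + X' := by
    rw [itemsVars_cons, add_assoc]
    rfl
  have hyX : y ∉ X' := by simp [X', hxy, hys, hyi]
  rw [hX] at hnd ⊢
  refine (hA (μ - (2 * N + 1)) (by lia) ((repeatList v (τ y)).reverse.map Letter.toItem ++ st) s x u
    inp w τ ⟨?_, ?_, hcp, hsl, hs, hsr, hinp, hwt, ?_, ?_⟩ ?_).lift (Pi.single y (τ y))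
    ?_ ?_ ?_ ?_ ?_ ?_ ?_
  · intro i hi
    rcases List.mem_append.1 hi with hi | hi
    · refine ok_letters (fun l hl => ?_) i hi
      exact hv.1.letters hv.2 l (mem_of_mem_repeatList (List.mem_reverse.1 hl))
    · exact hok i (List.mem_cons_of_mem _ hi)
  · rw [stackExpand_append, stackExpand_reverse_toItem, map_repeatList]
    simpa [Item.expand] using hred
  · rw [itemsVars_append, itemsVars_toItem, zero_add]
    exact (Multiset.nodup_add.1 hnd).2.1
  · simpa [Item.eval, -List.map_reverse] using hsol
  · rw [stackPot_append, stackPot_map_toItem, List.length_reverse, length_repeatList]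
    lia
  · intro z hz
    rw [itemsVars_append, itemsVars_toItem, zero_add] at hz
    exact Multiset.mem_add.2 (.inr hz)
  · intro z hz
    have : z ≠ y := by
      rintro rfl
      simp at hz
    simp [this]
  · intro z hz
    have : z ≠ y := by
      rintro rfl
      exact hz hyC
    simp [this]
  · intro z hz
    rw [itemsVars_append, itemsVars_toItem, zero_add] at hz
    have : z ≠ y := by
      rintro rfl
      exact hyX hz
    simp [this]
  · intro z hz hz'
    rw [itemsVars_append, itemsVars_toItem, zero_add] at hz'
    have := (Multiset.mem_add.1 hz).resolve_right hz'
    rw [Multiset.mem_singleton] at this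
    simp [this]
  · intro z
    by_cases hz : z = y
    · subst hz
      simp only [Pi.single_eq_same]
      lia
    · simp [hz]
  · intro t ht hE
    have hty := ht y (by simp) (by
      rw [itemsVars_append, itemsVars_toItem, zero_add]
      exact hyX)
    rw [stackEval_cons, stackEval_add_single hys, inputEval_add_single hyi]
    simpa [Item.eval, hty, hxy.symm, -List.map_reverse] using hE

/-- Cancel a power on the top of the stack as far as possible. -/
theorem Active.of_cpow_large {μ : ℕ} (hI : ∀ ν < μ, IdleGoal H S C N W κ ρ ν)
    {st inp : List (Item V G)} {s u v : List (Letter G)} {x y : V} {w : ℕ} {τ : V → ℕ}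
    (h : Active H S C N W (.cpow y v :: st) s x u inp w τ) (hy : u.length + s.length ≤ τ y)
    (hper : lettersEval v ^ u.length * (lettersEval s * lettersEval u ^ v.length) = lettersEval s →
      τ x < v.length)
    (hμ : stackPot N (.cpow y v :: st) + (10 * N ^ 2 + 6 * N + 5) + (if s = [] then 1 else 0) +
      inputPot N inp ≤ μ) :
    Cert C κ ρ μ (itemsVars (.cpow y v :: st) + ({x} + itemsVars inp)) τ
      fun t => stackEval (.cpow y v :: st) t *
        (lettersEval s * lettersEval u ^ t x * inputEval inp t) = 1 := by
  obtain ⟨hxy, hxs, hys, hxi, hyi⟩ := h.notMem_top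
  obtain ⟨hok, hred, hcp, hsl, hs, hsr, hinp, hwt, hnd, hsol⟩ := h
  have hv := hok _ List.mem_cons_self
  have hyC := hv.1.1
  have hxC := hcp.1
  have hul := hcp.2.2.1
  have hvl := hv.1.2.2.1
  have hv1 : 1 ≤ v.length := List.length_pos_iff.2 hv.1.2.1
  simp only [stackPot_cons, Item.stackPot] at hμ
  -- The numbers of copies to unroll: at most `|v|` of `u` and `|u| + |s|` of `v`, just enough for
  -- the `v`-side never to be the shorter one and for `periodic_cancellation` to apply when `b =
  -- |v|`.
  obtain ⟨b, hb⟩ : ∃ b, b = min (τ x) v.length := ⟨_, rfl⟩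
  obtain ⟨a, ha⟩ : ∃ a, a = u.length + s.length := ⟨_, rfl⟩
  obtain ⟨τ, rfl⟩ : ∃ τ' : V → ℕ, τ = τ' + Pi.single y a + Pi.single x b := by
    obtain ⟨τ, rfl⟩ := exists_eq_add_single (τ := τ) (x := x) (n := b) (by lia)
    obtain ⟨τ, rfl⟩ := exists_eq_add_single (τ := τ) (x := y) (n := a) (by simpa [ha, hxy] using hy)
    exact ⟨τ, rfl⟩
  have hτx : (τ + Pi.single y a + Pi.single x b : V → ℕ) x = τ x + b := by simp [hxy.symm]
  rw [hτx] at hb hper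
  rw [stackExpand_shift hxy hxs hys] at hred
  rw [active_eval_shift hxy hxs hys hxi hyi] at hsol
  have hsr' := hsr (b + τ x)
  rw [repeatList_add, ← List.append_assoc, ← map_repeatList, ← List.map_append] at hsr'
  set d : V → ℕ := Pi.single y a + Pi.single x b with hd
  have hdz : ∀ z, z ≠ x → z ≠ y → d z = 0 := fun z h1 h2 => by simp [hd, h1, h2]
  have hdX : ∀ z, z ∉ itemsVars (.cpow y v :: st) + ({x} + itemsVars inp) → d z = 0 := by
    intro z hz
    refine hdz z ?_ ?_ <;>
    · rintro rfl
      simp [Item.vars] at hz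
  have hdC : ∀ z, z ∉ C → d z = 0 := by
    intro z hz
    refine hdz z ?_ ?_ <;>
    · rintro rfl
      contradiction
  have hdμ : ∀ z, μ - (2 * N + 1) + d z ≤ μ := by
    intro z
    have h1 : d z ≤ 2 * N := by
      by_cases h1 : z = y
      · subst h1
        simp only [hd, Pi.add_apply, Pi.single_eq_same, Pi.single_eq_of_ne hxy]
        lia
      · by_cases h2 : z = x
        · subst h2
          simp only [hd, Pi.add_apply, Pi.single_eq_same, Pi.single_eq_of_ne h1]
          lia
        · simp [hdz z h2 h1]
    lia
  have hA : lettersEval v ^ a = lettersEval (repeatList v a) := by simp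
  have hB : lettersEval s * lettersEval u ^ b = lettersEval (s ++ repeatList u b) := by simp
  have hvw : ∀ l ∈ (repeatList v a).reverse, (∀ g ∈ l.2, g ∈ S l.1) ∧ l.2.length ≤ w := fun l hl =>
    hv.1.letters hv.2 l (mem_of_mem_repeatList (List.mem_reverse.1 hl))
  have huw : ∀ l ∈ s ++ repeatList u b, (∀ g ∈ l.2, g ∈ S l.1) ∧ l.2.length ≤ lettersLen u := by
    intro l hl
    rcases List.mem_append.1 hl with hl | hl
    · exact hs l hl
    · exact hcp.letters le_rfl l (mem_of_mem_repeatList hl)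
  have hAl : a * v.length ≤ 2 * N ^ 2 := by
    calc a * v.length ≤ (N + N) * N := Nat.mul_le_mul (by lia) hvl
      _ = 2 * N ^ 2 := by ring
  have hBl : b * u.length ≤ N ^ 2 := by
    rw [pow_two]
    exact Nat.mul_le_mul (by lia) hul
  have hlA : (repeatList v a).reverse.length = a * v.length := by simp
  have hlB : (s ++ repeatList u b).length = s.length + b * u.length := by simp
  rcases exists_cancellation (repeatList v a).reverse (s ++ repeatList u b) with
    ⟨Γ, A', hΓ, hcan⟩ | ⟨Γ, p, A', Δ, q, B', hΓ, hΔ, hcan, hpq⟩ | hlt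
  -- Everything incoming has cancelled. If `b` were `|v|`, the powers would satisfy the periodicity
  -- relation, against `hper`; hence all of the original exponent of `x` was unrolled and what is
  -- left of it is `0`.
  · have hlt : τ x + b < v.length := by
      by_contra! hge
      obtain rfl : b = v.length := by lia
      exact absurd (hper (periodic_cancellation hv.1.2.1 (ha ▸ hΓ) hcan)) (by lia)
    have hτ0 : τ x = 0 := by lia
    have hev : ∀ t : V → ℕ, t x = 0 →
        stackEval (.cpow y v :: st) (t + d) *
          (lettersEval s * lettersEval u ^ (t + d) x * inputEval inp (t + d)) =
        stackEval (A'.map Letter.toItem ++ .cpow y v :: st) t * inputEval inp t := by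
      intro t ht
      rw [hd, ← add_assoc, active_eval_shift hxy hxs hys hxi hyi, hA, hB,
        ← List.reverse_reverse (repeatList v a), hΓ, List.reverse_append, lettersEval_append,
        mul_assoc (lettersEval A'.reverse), lettersEval_of_forall₂ hcan, ht]
      simp [Item.eval, mul_assoc]
    refine (hI (μ - (2 * N + 1)) (by lia) (A'.map Letter.toItem ++ .cpow y v :: st) inp w τ
      ⟨?_, ?_, hinp, by lia, ?_, ?_⟩ ?_).lift d ?_ hdX hdC ?_ ?_ hdμ ?_
    · intro i hi
      rcases List.mem_append.1 hi with hi | hi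
      · exact ok_letters (fun l hl => hvw l (by rw [hΓ]; exact List.mem_append_right _ hl)) i hi
      · exact hok i hi
    · have : repeatList v a = A'.reverse ++ Γ.reverse := by
        rw [← List.reverse_append, ← hΓ, List.reverse_reverse]
      rw [this, List.map_append, ← List.append_assoc] at hred
      rw [stackExpand_append, stackExpand_toItem, ← List.map_reverse]
      exact hred.left
    · rw [add_left_comm] at hnd
      simpa using (Multiset.nodup_add.1 hnd).2.1
    · rw [← hev τ hτ0, hd, ← add_assoc, active_eval_shift hxy hxs hys hxi hyi, hsol]
    · rw [stackPot_append, stackPot_map_toItem, stackPot_cons, Item.stackPot]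
      have := congrArg List.length hΓ
      rw [List.length_append, hlA] at this
      lia
    · intro z hz
      simp only [itemsVars_append, itemsVars_toItem, zero_add, Multiset.mem_add] at hz ⊢
      tauto
    · intro z _
      simp [hd, add_assoc]
    · intro z hz hz'
      simp only [itemsVars_append, itemsVars_toItem, zero_add, Multiset.mem_add,
        Multiset.mem_singleton] at hz hz'
      obtain rfl : z = x := by tauto
      simp [hd, hτ0]
    · intro t ht hE
      have htx : t x = 0 := ht x (by simp) (by
        simp [Item.vars, hxy.symm, hxs, hxi])
      rw [hev t htx, hE]
  · have hlΓ := congrArg List.length hΓ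
    have hlΔ := congrArg List.length hΔ
    rw [hlA, List.length_append, List.length_cons] at hlΓ
    rw [hlB, List.length_append, List.length_cons] at hlΔ
    have hAe : repeatList v a = A'.reverse ++ [p] ++ Γ.reverse := by
      rw [← List.reverse_reverse (repeatList v a), hΓ]
      simp
    have hev : ∀ t : V → ℕ,
        stackEval (.cpow y v :: st) (t + d) *
          (lettersEval s * lettersEval u ^ (t + d) x * inputEval inp (t + d)) =
        stackEval (A'.map Letter.toItem ++ .cpow y v :: st) t * (p.2.prod * q.2.prod) *
          (lettersEval B' * lettersEval u ^ t x * inputEval inp t) := by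
      intro t
      rw [hd, ← add_assoc, active_eval_shift hxy hxs hys hxi hyi, hA, hB, hAe, hΔ]
      have h1 : lettersEval Δ = (lettersEval Γ.reverse)⁻¹ :=
        eq_inv_of_mul_eq_one_right (lettersEval_of_forall₂ hcan)
      simp [Item.eval, mul_assoc, h1]
    rw [← active_eval_shift hxy hxs hys hxi hyi, add_assoc, hev] at hsol
    rw [hAe, List.map_append, List.map_append, ← List.append_assoc] at hred
    have hred := hred.left
    rw [← List.append_assoc] at hred
    rw [hΔ, List.map_append, List.append_assoc] at hsr'
    have hsr' := hsr'.right
    rw [List.map_cons, List.cons_append] at hsr'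
    have hexp : stackExpand (A'.map Letter.toItem ++ .cpow y v :: st) τ =
        stackExpand (.cpow y v :: st) τ ++ A'.reverse.map Letter.val := by
      rw [stackExpand_append, stackExpand_toItem, ← List.map_reverse]
    rw [← hexp] at hred
    have hokA : ∀ i ∈ (A'.map Letter.toItem ++ .cpow y v :: st : List (Item V G)),
        i.OK H S C N ∧ i.wt ≤ w := by
      intro i hi
      rcases List.mem_append.1 hi with hi | hi
      · exact ok_letters (fun l hl => hvw l (by rw [hΓ]; simp [hl])) i hi
      · exact hok i hi
    have hp := hvw p (by simp [hΓ])
    have hq := huw q (by simp [hΔ])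
    have hB' : ∀ l ∈ B', (∀ g ∈ l.2, g ∈ S l.1) ∧ l.2.length ≤ lettersLen u :=
      fun l hl => huw l (by simp [hΔ, hl])
    -- Cancellation stopped at the letters `p` and `q`. If their labels differ, both survive; if
    -- not, they merge into one nontrivial syllable. `i` is the resulting stack item and `s'` the
    -- remainder, so both cases continue uniformly without further cancellation.
    obtain ⟨i, s', hi, hs', hired, hivars, hieval, hipot⟩ : ∃ (i : Item V G) (s' : List (Letter G)),
        (i.OK H S C N ∧ i.wt ≤ w + lettersLen u) ∧
        (∀ l ∈ s', (∀ g ∈ l.2, g ∈ S l.1) ∧ l.2.length ≤ lettersLen u) ∧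
        IsReduced H (stackExpand (i :: (A'.map Letter.toItem ++ .cpow y v :: st)) τ ++
          (s'.map Letter.val ++ repeatList (u.map Letter.val) (τ x))) ∧
        i.vars = 0 ∧ (∀ t, i.eval t * lettersEval s' = p.2.prod * q.2.prod * lettersEval B') ∧
        i.stackPot N + 2 * s'.length ≤ 2 + 2 * (B'.length + 1) := by
      rcases hpq with hpq | ⟨hpq, hpq1⟩
      · refine ⟨p.toItem, q :: B', ⟨Letter.ok_toItem hp.1, ?_⟩, ?_, ?_, vars_toItem p, ?_, ?_⟩
        · rw [wt_toItem]
          exact hp.2.trans (Nat.le_add_right _ _)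
        · intro l hl
          rcases List.mem_cons.1 hl with rfl | hl
          · exact hq
          · exact hB' l hl
        · rw [stackExpand_cons, expand_toItem, List.map_cons, List.cons_append]
          exact hred.join hsr' hpq
        · intro t
          simp [mul_assoc]
        · simp
      · have hqp : ∀ g ∈ q.2, g ∈ S p.1 := hpq ▸ hq.1
        refine ⟨.syl p.1 [(none, p.2), (none, q.2)], B', ⟨?_, ?_⟩, hB', ?_, by simp [Item.vars, fragVars],
          ?_, ?_⟩
        · exact Item.OK.append (F := [(none, p.2)]) (Letter.ok_toItem hp.1)
            (Letter.ok_toItem (l := (p.1, q.2)) hqp)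
        · simp only [Item.wt, fragLen, List.map_cons, List.map_nil, List.sum_cons, List.sum_nil]
          lia
        · rw [stackExpand_cons, Item.expand, ← List.append_assoc]
          have := hred.merge hsr' hpq hpq1
          simpa [Letter.val, fragEval, Atom.eval] using this
        · intro t
          simp [Item.eval, fragEval, Atom.eval]
        · simp only [Item.stackPot]
          lia
    have hre : ∀ t : V → ℕ, stackEval (i :: (A'.map Letter.toItem ++ .cpow y v :: st)) t *
          (lettersEval s' * lettersEval u ^ t x * inputEval inp t) =
        stackEval (A'.map Letter.toItem ++ .cpow y v :: st) t * (p.2.prod * q.2.prod) *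
          (lettersEval B' * lettersEval u ^ t x * inputEval inp t) := by
      intro t
      calc _ = stackEval (A'.map Letter.toItem ++ .cpow y v :: st) t *
            (i.eval t * lettersEval s') * (lettersEval u ^ t x * inputEval inp t) := by
            rw [stackEval_cons]
            simp only [mul_assoc]
        _ = _ := by
            rw [hieval]
            simp only [mul_assoc]
    refine (push_power (hI (μ - (2 * N + 1)) (by lia)) (w := w + lettersLen u)
      (st := i :: (A'.map Letter.toItem ++ .cpow y v :: st)) (s := s') (x := x) (u := u)
      (inp := inp) (τ := τ) ?_ (fun l hl => ⟨(hs' l hl).1, (hs' l hl).2.trans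
        (Nat.le_add_left _ _)⟩) hcp (Nat.le_add_left _ _) hired hinp hwt ?_ ?_ ?_).lift d ?_
        hdX hdC ?_ ?_ hdμ ?_
    · intro k hk
      rcases List.mem_cons.1 hk with rfl | hk
      · exact hi
      · exact ⟨(hokA k hk).1, (hokA k hk).2.trans (Nat.le_add_right _ _)⟩
    · simpa [hivars] using hnd
    · rw [hre, hsol]
    · rw [stackPot_cons, stackPot_append, stackPot_map_toItem, stackPot_cons, Item.stackPot]
      lia
    · intro z hz
      simpa [hivars] using hz
    · intro z _
      simp [hd, add_assoc]
    · intro z hz hz'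
      exact absurd (by simpa [hivars] using hz) hz'
    · intro t _ hE
      rw [hev, ← hre, hE]
  -- The `v`-side cannot run out first: `|u| |v| + |s| |v| ≥ b |u| + |s|`, because `b ≤ |v|` and `1
  -- ≤ |v|`.
  · rw [hlA, hlB, ha, add_mul] at hlt
    have h1 : s.length ≤ s.length * v.length := Nat.le_mul_of_pos_right _ hv1
    have h2 : b * u.length ≤ u.length * v.length := by
      rw [mul_comm]
      exact Nat.mul_le_mul_left _ (by lia)
    lia

/-- While the periodicity relation holds and both exponents are large, a period is subtracted from
the solution at no cost in potential and restored by `Cert.pump`. This terminates since the exponent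
of `y` drops by `|u| ≥ 1` each time; afterwards one of the two previous cases applies. -/
theorem Active.of_cpow (hM : Machine H S C N W κ ρ) {μ : ℕ}
    (hI : ∀ ν < μ, IdleGoal H S C N W κ ρ ν) (hA : ∀ ν < μ, ActiveGoal H S C N W κ ρ ν)
    {st inp : List (Item V G)} {s u v : List (Letter G)} {x y : V} {w : ℕ} {τ : V → ℕ}
    (h : Active H S C N W (.cpow y v :: st) s x u inp w τ)
    (hμ : stackPot N (.cpow y v :: st) + (10 * N ^ 2 + 6 * N + 5) + (if s = [] then 1 else 0) +
      inputPot N inp ≤ μ) :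
    Cert C κ ρ μ (itemsVars (.cpow y v :: st) + ({x} + itemsVars inp)) τ
      fun t => stackEval (.cpow y v :: st) t *
        (lettersEval s * lettersEval u ^ t x * inputEval inp t) = 1 := by
  obtain ⟨n, hn⟩ : ∃ n, τ y = n := ⟨_, rfl⟩
  induction n using Nat.strong_induction_on generalizing τ with
  | _ n ih =>
    by_cases hy : τ y ≤ u.length + s.length
    · exact h.of_cpow_small hA hy hμ
    by_cases hper : lettersEval v ^ u.length * (lettersEval s * lettersEval u ^ v.length) =
        lettersEval s ∧ v.length ≤ τ x
    · obtain ⟨hper, hx⟩ := hper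
      obtain ⟨hxy, hxs, hys, hxi, hyi⟩ := h.notMem_top
      obtain ⟨hok, hred, hcp, hsl, hs, hsr, hinp, hwt, hnd, hsol⟩ := h
      obtain ⟨τ, rfl⟩ : ∃ τ' : V → ℕ,
          τ = τ' + Pi.single y u.length + Pi.single x v.length := by
        obtain ⟨τ, rfl⟩ := exists_eq_add_single hx
        obtain ⟨τ, rfl⟩ := exists_eq_add_single (τ := τ) (x := y) (n := u.length) (by
          simp only [Pi.add_apply, Pi.single_eq_of_ne hxy] at hy
          lia)
        exact ⟨τ, rfl⟩
      have hu1 : 1 ≤ u.length := List.length_pos_iff.2 hcp.2.1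
      have hul := hcp.2.2.1
      have hvl := (hok _ List.mem_cons_self).1.2.2.1
      have hev : ∀ t : V → ℕ, stackEval (.cpow y v :: st)
            (t + Pi.single y u.length + Pi.single x v.length) *
          (lettersEval s * lettersEval u ^
            (t + Pi.single y u.length + Pi.single x v.length : V → ℕ) x *
            inputEval inp (t + Pi.single y u.length + Pi.single x v.length)) =
          stackEval (.cpow y v :: st) t * (lettersEval s * lettersEval u ^ t x * inputEval inp t) := by
        intro t
        rw [active_eval_shift hxy hxs hys hxi hyi, hper]
        simp only [stackEval_cons, Item.eval, mul_assoc]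
      rw [stackExpand_shift hxy hxs hys] at hred
      refine (ih (τ y) ?_ ⟨hok, hred.left, hcp, hsl, hs, hsr, hinp, hwt, hnd, (hev τ).symm.trans hsol⟩
        rfl).pump (Pi.single y u.length + Pi.single x v.length) ?_ ?_ (add_assoc _ _ _) ?_
      · rw [← hn]
        simp only [Pi.add_apply, Pi.single_eq_same]
        lia
      · intro z hz
        have h1 : z ≠ y ∧ z ≠ x := by
          constructor <;>
          · rintro rfl
            simp [Item.vars] at hz
        simp [h1]
      · intro z
        -- The entries of the period are `|u|` and `|v|`, both at most `N`.
        refine le_trans ?_ hM.le_rho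
        by_cases h1 : z = y
        · subst h1
          simpa [hxy] using hul
        · by_cases h2 : z = x
          · subst h2
            simpa [h1] using hvl
          · simp [h1, h2]
      · intro t ht
        rw [← add_assoc, hev, ht]
    · exact h.of_cpow_large hI (by lia) (fun h1 => by
        by_contra! h2
        exact hper ⟨h1, h2⟩) hμ

theorem idleGoal_and_activeGoal (hM : Machine H S C N W κ ρ) (μ : ℕ) :
    IdleGoal H S C N W κ ρ μ ∧ ActiveGoal H S C N W κ ρ μ := by
  induction μ using Nat.strong_induction_on with
  | _ μ ih =>
    have hI := fun ν hν => (ih ν hν).1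
    have hA := fun ν hν => (ih ν hν).2
    refine ⟨idleGoal_of_lt hM hI hA, ?_⟩
    intro st s x u inp w τ h hμ
    rcases st with _ | ⟨⟨j, F⟩ | ⟨y, v⟩, st⟩
    · exact h.of_nil hI hμ
    · cases s with
      | nil => exact h.of_syl_nil hI hA hμ
      | cons q s => exact h.of_syl_cons hM hI hA hμ
    · exact h.of_cpow hM hI hA hμ

/-- The stack machine finds a certificate for every solution of an equation between items. -/
theorem cert_of_items (hM : Machine H S C N W κ ρ) {inp : List (Item V G)} {τ : V → ℕ}
    (hok : ∀ i ∈ inp, i.OK H S C N) (hwt : inputWt inp ≤ W) (hnd : (itemsVars inp).Nodup)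
    (hsol : inputEval inp τ = 1) :
    Cert C κ ρ (inputPot N inp) (itemsVars inp) τ fun y => inputEval inp y = 1 :=
  ((idleGoal_and_activeGoal hM (inputPot N inp)).1 [] inp 0 τ ⟨by simp, isReduced_nil, hok, by simpa using hwt,
    by simpa using hnd, by simpa using hsol⟩ (by simp)).congr (by simp) le_rfl
    (fun y hy => by simpa using hy)

end Machine

/-! ### Words over a generating set and linear sets of solutions bounded by `K` -/

section Words

variable {A : Type*} [Group A] {T : Set A}

theorem evalWord_eq (w : List T) : evalWord w = (w.map Subtype.val).prod := by simp [evalWord]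

@[simp] theorem evalWord_nil : evalWord ([] : List T) = 1 := rfl

@[simp] theorem evalWord_cons (a : T) (w : List T) : evalWord (a :: w) = a * evalWord w := by
  simp [evalWord]

@[simp] theorem evalWord_append (w w' : List T) :
    evalWord (w ++ w') = evalWord w * evalWord w' := by simp [evalWord]

theorem evalWord_flatten (L : List (List T)) : evalWord L.flatten = (L.map evalWord).prod := by
  induction L with
  | nil => rfl
  | cons w L ih => simp [ih]

theorem evalWord_valuate (e : Expr T) (σ : Fin e.deg → ℕ) :
    evalWord (e.valuate σ) =
      (List.ofFn fun i => evalWord (e.period i) ^ σ i * evalWord (e.const i)).prod := by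
  rw [Expr.valuate, evalWord_flatten, List.map_ofFn]
  congr 2
  ext i
  simp [evalWord_flatten]

theorem LinearRep.norm_le_norm {d : ℕ} {R : SemilinearRep d} {L : LinearRep d} (h : L ∈ R) :
    L.norm ≤ SemilinearRep.norm R := by
  induction R with
  | nil => simp at h
  | cons L' R ih =>
    simp only [SemilinearRep.norm, List.map_cons, List.foldr_cons] at ih ⊢
    rcases List.mem_cons.1 h with rfl | h
    · exact le_max_left _ _
    · exact (ih h).trans (le_max_right _ _)

/-- Solutions lie in linear sets of solutions whose norm is controlled by `K`. -/
theorem exists_linearRep_le_K (hT : T.Finite) (hs : IsKnapsackSemilinear T) {e : Expr T} {n m : ℕ}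
    (hn : e.length ≤ n) (hm : e.deg ≤ m) {σ : Fin e.deg → ℕ} (hσ : σ ∈ e.sol) :
    ∃ L : LinearRep e.deg, σ ∈ L.toSet ∧ L.toSet ⊆ e.sol ∧ L.norm ≤ K T n m := by
  obtain ⟨R, hR, hRn⟩ : ∃ R : SemilinearRep e.deg, R.toSet = e.sol ∧ R.norm = mag e.sol := by
    obtain ⟨R, hR⟩ := (isSemilinearSet_iff_exists_rep _).1 (hs e)
    exact Nat.sInf_mem (s := {N | ∃ R : SemilinearRep e.deg, R.toSet = e.sol ∧ R.norm = N})
      ⟨_, R, hR, rfl⟩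
  have hK : mag e.sol ≤ K T n m := by
    refine le_csSup ?_ ⟨e, ⟨⟨σ, hσ⟩, hn, hm⟩, rfl⟩
    exact ((finite_knap hT n m).image fun e => mag e.sol).bddAbove
  rw [← hR] at hσ
  obtain ⟨L, hL, hσL⟩ := hσ
  refine ⟨L, hσL, ?_, (LinearRep.norm_le_norm hL).trans (hRn.trans_le hK)⟩
  rw [← hR]
  exact fun x hx => ⟨L, hL, hx⟩

end Words

/-! ### Certificates for syllables from the knapsack function of a factor -/

section Block

variable {G : Type*} [Group G] {V : Type*} {A : Type*} [Group A] {T : Set A}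

/-- The value of an expression given by a list of triples `(x, u, v)` at an assignment. -/
def listEval (l : List (V × List T × List T)) (y : V → ℕ) : A :=
  (l.map fun t => evalWord t.2.1 ^ y t.1 * evalWord t.2.2).prod

theorem exists_word_of_image (φ : A →* G) {w : List G} (h : ∀ g ∈ w, g ∈ φ '' T) :
    ∃ w' : List T, φ (evalWord w') = w.prod ∧ w'.length = w.length := by
  induction w with
  | nil => exact ⟨[], by simp⟩
  | cons g w ih =>
    obtain ⟨w', h1, h2⟩ := ih fun g hg => h g (List.mem_cons_of_mem _ hg)
    obtain ⟨a, ha, rfl⟩ := h g List.mem_cons_self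
    exact ⟨⟨a, ha⟩ :: w', by simp [h1], by simp [h2]⟩

/-- Consecutive constants are absorbed into the power preceding them, so that the atoms take the
shape of a knapsack expression apart from the leading constant `c`, which has no power before it. -/
theorem exists_list_of_frag (φ : A →* G) {F : List (Atom V G)}
    (h : ∀ a ∈ F, (∀ g ∈ a.2, g ∈ φ '' T) ∧ ∀ x, a.1 = some x → a.2 ≠ []) :
    ∃ (c : List T) (l : List (V × List T × List T)),
      (∀ y, fragEval F y = φ (evalWord c * listEval l y)) ∧
      c.length + (l.map fun t => t.2.1.length + t.2.2.length).sum = fragLen F ∧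
      fragVars F = (l.map Prod.fst : List V) ∧ ∀ t ∈ l, t.2.1 ≠ [] := by
  induction F with
  | nil => exact ⟨[], [], by simp [fragEval, listEval, fragLen, fragVars]⟩
  | cons a F ih =>
    obtain ⟨c, l, h1, h2, h3, h4⟩ := ih fun a ha => h a (List.mem_cons_of_mem _ ha)
    have ha := h a List.mem_cons_self
    obtain ⟨o, w⟩ := a
    obtain ⟨w', hw1, hw2⟩ := exists_word_of_image φ ha.1
    have e1 : ∀ y, fragEval ((o, w) :: F) y = fragEval [(o, w)] y * fragEval F y :=
      fragEval_append [_] F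
    have e2 : fragLen ((o, w) :: F) = w.length + fragLen F := by simp [fragLen]
    cases o with
    | none =>
      refine ⟨w' ++ c, l, fun y => ?_, ?_, ?_, h4⟩
      · simp only [e1, fragEval_const, h1, evalWord_append, map_mul, mul_assoc, ← hw1]
      · rw [e2, ← h2, List.length_append, hw2, add_assoc]
      · rw [← h3]
        simp [fragVars]
    | some x =>
      refine ⟨[], (x, w', c) :: l, fun y => ?_, ?_, ?_, ?_⟩
      · have e3 : fragEval [((some x, w) : Atom V G)] y = w.prod ^ y x := by
          simp [fragEval, Atom.eval]
        rw [e1, e3, h1]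
        simp only [← hw1]
        simp [listEval, mul_assoc]
      · rw [e2, ← h2]
        simp [hw2, add_assoc]
      · have e3 : fragVars ((some x, w) :: F) = x ::ₘ fragVars F := by simp [fragVars]
        rw [e3, h3]
        simp
      · intro t ht
        rcases List.mem_cons.1 ht with rfl | ht
        · have := ha.2 x rfl
          rw [← List.length_pos_iff] at this ⊢
          simpa [hw2] using this
        · exact h4 t ht

/-- The knapsack expression given by a list of triples. -/
def Expr.ofList (l : List (V × List T × List T)) (hl : l ≠ []) (h : ∀ t ∈ l, t.2.1 ≠ []) :
    Expr T where
  deg := l.length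
  deg_pos := List.length_pos_iff.2 hl
  period i := (l.get i).2.1
  const i := (l.get i).2.2
  period_ne_nil i := h _ (List.get_mem l i)

theorem Expr.mem_sol_ofList {l : List (V × List T × List T)} {hl : l ≠ []}
    {h : ∀ t ∈ l, t.2.1 ≠ []} {y : V → ℕ} :
    (fun i => y (l.get i).1) ∈ (Expr.ofList l hl h).sol ↔ listEval l y = 1 := by
  change evalWord ((Expr.ofList l hl h).valuate fun i => y (l.get i).1) = 1 ↔ _
  rw [evalWord_valuate, listEval]
  have : (List.ofFn fun i => evalWord ((Expr.ofList l hl h).period i) ^ y (l.get i).1 *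
      evalWord ((Expr.ofList l hl h).const i)) =
      l.map fun t => evalWord t.2.1 ^ y t.1 * evalWord t.2.2 := by
    conv_rhs => rw [← List.ofFn_get l, List.map_ofFn]
    rfl
  rw [this]

theorem Expr.length_ofList {l : List (V × List T × List T)} {hl : l ≠ []}
    {h : ∀ t ∈ l, t.2.1 ≠ []} :
    (Expr.ofList l hl h).length = (l.map fun t => t.2.1.length + t.2.2.length).sum := by
  conv_rhs => rw [← List.ofFn_get l, List.map_ofFn, List.sum_ofFn]
  rfl

/-- A linear set in the coordinates `f i` gives a certificate. -/
theorem cert_of_linearRep {C : Set V} {κ ρ : ℕ} {X : Multiset V} {τ : V → ℕ}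
    {E : (V → ℕ) → Prop} {r : ℕ} {f : Fin r → V} (hf : Function.Injective f)
    (hX : ∀ x, x ∈ X ↔ ∃ i, f i = x) (hC : ∀ x ∈ X, x ∉ C) {L : LinearRep r}
    (hκ : L.norm ≤ κ) (hρ : L.norm ≤ ρ) (hτ : τ ∘ f ∈ L.toSet)
    (hE : ∀ y, y ∘ f ∈ L.toSet → E y) : Cert C κ ρ 0 X τ E := by
  let ext : (Fin r → ℕ) →+ (V → ℕ) :=
    { toFun := fun c => Function.extend f c 0
      map_zero' := by
        ext x
        by_cases hx : ∃ i, f i = x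
        · obtain ⟨i, rfl⟩ := hx
          simp [hf.extend_apply]
        · simp [Function.extend_apply' _ _ _ hx]
      map_add' := fun c c' => by
        ext x
        by_cases hx : ∃ i, f i = x
        · obtain ⟨i, rfl⟩ := hx
          simp [hf.extend_apply]
        · simp [Function.extend_apply' _ _ _ hx] }
  have ext_f : ∀ c i, ext c (f i) = c i := fun c i => hf.extend_apply _ _ _
  have ext_not : ∀ c x, x ∉ X → ext c x = 0 := fun c x hx =>
    Function.extend_apply' _ _ _ fun h => hx ((hX x).2 h)
  have ext_le : ∀ c N, (∀ i, c i ≤ N) → ∀ x, ext c x ≤ N := by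
    intro c N hc x
    by_cases hx : x ∈ X
    · obtain ⟨i, rfl⟩ := (hX x).1 hx
      rw [ext_f]
      exact hc i
    · rw [ext_not c x hx]
      exact Nat.zero_le _
  have hb : ∀ i, L.base i ≤ L.norm := fun i =>
    (Finset.le_sup (f := L.base) (Finset.mem_univ i)).trans (le_max_left _ _)
  have hp : ∀ i j, L.periods i j ≤ L.norm := fun i j =>
    ((Finset.le_sup (f := fun j => L.periods i j) (Finset.mem_univ j)).trans
      (Finset.le_sup (f := fun i => Finset.univ.sup fun j => L.periods i j)
        (Finset.mem_univ i))).trans (le_max_right _ _)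
  rw [L.toSet_eq_vadd, Set.mem_vadd_set] at hτ
  obtain ⟨q, hq, hqτ⟩ := hτ
  refine ⟨ext L.base, ext '' Set.range fun j i => L.periods i j, ext_not _, ?_,
    fun x _ => (ext_le _ _ hb x).trans hκ, ?_, ?_, ⟨ext q, ?_, ?_⟩, ?_⟩
  · rintro _ ⟨c, -, rfl⟩
    exact ext_not c
  · intro x hx
    rw [ext_not _ x fun h => hC x h hx]
  · rintro _ ⟨_, ⟨j, rfl⟩, rfl⟩ x
    exact (ext_le _ _ (fun i => hp i j) x).trans hρ
  · rw [← AddMonoidHom.map_mclosure]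
    exact ⟨q, hq, rfl⟩
  · intro x hx
    obtain ⟨i, rfl⟩ := (hX x).1 hx
    rw [ext_f, ext_f]
    exact (congrFun hqτ i).symm
  · intro y p hp hy
    rw [← AddMonoidHom.map_mclosure] at hp
    obtain ⟨q, hq, rfl⟩ := hp
    refine hE y ?_
    rw [L.toSet_eq_vadd, Set.mem_vadd_set]
    refine ⟨q, hq, ?_⟩
    ext i
    have := hy (f i) ((hX _).2 ⟨i, rfl⟩)
    rw [ext_f, ext_f] at this
    exact this.symm

/-- The certificates for syllables that come from the function `K` of a factor. -/
theorem cert_of_frag [Fintype V] (hT : T.Finite) (hs : IsKnapsackSemilinear T) {φ : A →* G}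
    (hφ : Function.Injective φ) {C : Set V} {κ ρ W m : ℕ} (hm : Fintype.card V ≤ m)
    (hκ : K T W m ≤ κ) (hρ : K T W m ≤ ρ) {F : List (Atom V G)} {τ : V → ℕ}
    (hF : ∀ a ∈ F, (∀ g ∈ a.2, g ∈ φ '' T) ∧ ∀ x, a.1 = some x → x ∉ C ∧ a.2 ≠ [])
    (hW : fragLen F ≤ W) (hnd : (fragVars F).Nodup) (hτ : fragEval F τ = 1) :
    Cert C κ ρ 0 (fragVars F) τ fun y => fragEval F y = 1 := by
  have hC : ∀ x ∈ fragVars F, x ∉ C := by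
    intro x hx
    simp only [fragVars, Multiset.mem_coe, List.mem_filterMap] at hx
    obtain ⟨a, ha, hax⟩ := hx
    exact ((hF a ha).2 x hax).1
  obtain ⟨c, l, h1, h2, h3, h4⟩ := exists_list_of_frag φ
    fun a ha => ⟨(hF a ha).1, fun x hx => ((hF a ha).2 x hx).2⟩
  have h1' : ∀ y, fragEval F y = 1 ↔ evalWord c * listEval l y = 1 := fun y => by
    rw [h1, map_eq_one_iff φ hφ]
  rcases List.eq_nil_or_concat l with rfl | ⟨l', ⟨x, u, v⟩, rfl⟩
  · rw [h1'] at hτ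
    refine Cert.trivial ?_ fun y _ => (h1' y).2 hτ
    rw [h3]
    simp
  -- The leading constant is rotated to the end. This conjugates the value and so does not affect
  -- whether it is `1`, and the total length stays the same.
  · set l'' := l' ++ [(x, u, v ++ c)] with hl''
    have hfst : (l' ++ [(x, u, v)]).map Prod.fst = l''.map Prod.fst := by simp [hl'']
    rw [List.concat_eq_append] at h1' h2 h3 h4
    have hE : ∀ y, fragEval F y = 1 ↔ listEval l'' y = 1 := by
      intro y
      have e : listEval l'' y = listEval (l' ++ [(x, u, v)]) y * evalWord c := by
        simp [listEval, hl'', mul_assoc]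
      rw [h1', e, mul_eq_one_iff_eq_inv, mul_eq_one_iff_inv_eq, eq_comm]
    have hne : ∀ t ∈ l'', t.2.1 ≠ [] := by
      intro t ht
      rcases List.mem_append.1 ht with ht | ht
      · exact h4 t (List.mem_append_left _ ht)
      · rw [List.mem_singleton.1 ht]
        exact h4 (x, u, v) (by simp)
    have hlen : (Expr.ofList l'' (by simp [hl'']) hne).length ≤ W := by
      rw [Expr.length_ofList]
      refine le_trans (le_of_eq ?_) hW
      rw [← h2]
      simp [hl'']
      ring
    rw [hfst] at h3
    rw [h3, Multiset.coe_nodup] at hnd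
    -- The variables are distinct elements of `V`, so there are at most `Fintype.card V` of them.
    have hdeg : (Expr.ofList l'' (by simp [hl'']) hne).deg ≤ m := by
      refine le_trans ?_ hm
      have := hnd.length_le_card
      rwa [List.length_map] at this
    obtain ⟨L, hL1, hL2, hL3⟩ := exists_linearRep_le_K hT hs hlen hdeg
      (Expr.mem_sol_ofList.2 ((hE τ).1 hτ))
    refine cert_of_linearRep (f := fun i => (l''.get i).1) ?_ ?_ hC (hL3.trans hκ) (hL3.trans hρ)
      hL1 ?_
    · intro i j hij
      have := List.nodup_iff_injective_get.1 hnd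
      have h' := @this (i.cast (by simp)) (j.cast (by simp)) (by simpa using hij)
      simpa [Fin.ext_iff] using h'
    · intro y
      rw [h3, Multiset.mem_coe, List.mem_map]
      constructor
      · rintro ⟨t, ht, rfl⟩
        obtain ⟨i, rfl⟩ := List.get_of_mem ht
        exact ⟨i, rfl⟩
      · rintro ⟨i, rfl⟩
        exact ⟨_, List.get_mem l'' i, rfl⟩
    · intro y hy
      exact (hE y).2 (Expr.mem_sol_ofList.1 (hL2 hy))

end Block

/-! ### Reduced and cyclically reduced forms of words -/

section CyclicReduction

variable {G : Type*} [Group G] {H : Bool → Subgroup G} {S : Bool → Set G}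

/-- Generators are multiplied on from the left; each is dropped if trivial, starts a new letter, or
joins the first letter, which is deleted if the product is `1`. No case needs additional generators.
-/
theorem exists_reduced_letters (hS : ∀ j, ∀ g ∈ S j, g ∈ H j) {w : List G}
    (hw : ∀ g ∈ w, ∃ j, g ∈ S j) :
    ∃ l : List (Letter G), IsReduced H (l.map Letter.val) ∧ (∀ p ∈ l, ∀ g ∈ p.2, g ∈ S p.1) ∧
      lettersEval l = w.prod ∧ lettersLen l ≤ w.length := by
  induction w with
  | nil => exact ⟨[], isReduced_nil, by simp, rfl, le_rfl⟩
  | cons g w ih =>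
    obtain ⟨l, h1, h2, h3, h4⟩ := ih fun g hg => hw g (List.mem_cons_of_mem _ hg)
    obtain ⟨j, hj⟩ := hw g List.mem_cons_self
    by_cases hg : g = 1
    · exact ⟨l, h1, h2, by simp [hg, h3], h4.trans (by simp)⟩
    have hg' : IsReduced H ([] ++ [((j, g) : Bool × G)]) := isReduced_singleton (hS j g hj) hg
    have hcons : IsReduced H ((j, g) :: l.map Letter.val) →
        ∃ l : List (Letter G), IsReduced H (l.map Letter.val) ∧ (∀ p ∈ l, ∀ g ∈ p.2, g ∈ S p.1) ∧
          lettersEval l = (g :: w).prod ∧ lettersLen l ≤ (g :: w).length := by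
      intro h
      refine ⟨(j, [g]) :: l, by simpa [Letter.val] using h, ?_, by simp [h3], ?_⟩
      · intro p hp
        rcases List.mem_cons.1 hp with rfl | hp
        · simpa using hj
        · exact h2 p hp
      · simp only [lettersLen, List.map_cons, List.sum_cons, List.length_cons] at h4 ⊢
        simp only [List.length_nil]
        lia
    rcases l with _ | ⟨p, l⟩
    · exact hcons hg'
    · by_cases hpj : j = p.1
      · subst hpj
        simp only [lettersEval_cons, lettersLen, List.map_cons, List.sum_cons] at h1 h3 h4
        have h2' : ∀ q ∈ l, ∀ g ∈ q.2, g ∈ S q.1 := fun q hq => h2 q (List.mem_cons_of_mem _ hq)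
        by_cases hgp : g * p.2.prod = 1
        · refine ⟨l, IsReduced.right (l := [p.val]) h1, h2', ?_, ?_⟩
          · rw [List.prod_cons, ← h3, ← mul_assoc, hgp, one_mul]
          · simp only [lettersLen, List.length_cons]
            lia
        · refine ⟨(p.1, g :: p.2) :: l, ?_, ?_, ?_, ?_⟩
          · simpa [Letter.val] using hg'.merge h1 rfl (by simpa [Letter.val] using hgp)
          · intro q hq
            rcases List.mem_cons.1 hq with rfl | hq
            · intro a ha
              rcases List.mem_cons.1 ha with rfl | ha
              · exact hj
              · exact h2 p List.mem_cons_self a ha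
            · exact h2' q hq
          · simp [← h3, mul_assoc]
          · simp only [lettersLen, List.map_cons, List.sum_cons, List.length_cons]
            lia
      · exact hcons (hg'.join h1 hpj)

theorem isReduced_repeatList {l : List (Bool × G)} (h : IsReduced H l)
    (hl : ∀ a ∈ l.getLast?, ∀ b ∈ l.head?, a.1 ≠ b.1) (n : ℕ) : IsReduced H (repeatList l n) := by
  induction n with
  | zero => exact isReduced_nil
  | succ n ih =>
    rw [repeatList_succ, isReduced_append]
    refine ⟨h, ih, fun a ha b hb => hl a ha b ?_⟩
    cases n with
    | zero => simp at hb
    | succ n =>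
      rw [repeatList_succ] at hb
      cases l with
      | nil => simp at ha
      | cons c l => simpa using hb

/-- Conjugates `p w p⁻¹` with `w` a nonempty word over one of the two alphabets. -/
def IsSimpleConj (S : Bool → Set G) (n : ℕ) (g : G) : Prop :=
  ∃ (p : List G) (j : Bool) (w : List G), (∀ a ∈ p, ∃ j, a ∈ S j) ∧ p.length ≤ n ∧ w ≠ [] ∧
    (∀ a ∈ w, a ∈ S j) ∧ w.length ≤ n ∧ g = p.prod * w.prod * p.prod⁻¹

/-- Conjugates `p c p⁻¹` with `c` a cyclically reduced list of letters. -/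
def IsCyclicConj (H : Bool → Subgroup G) (S : Bool → Set G) (n : ℕ) (g : G) : Prop :=
  ∃ (p : List G) (c : List (Letter G)), (∀ a ∈ p, ∃ j, a ∈ S j) ∧ p.length ≤ n ∧ c ≠ [] ∧
    (∀ l ∈ c, ∀ a ∈ l.2, a ∈ S l.1) ∧ lettersLen c ≤ n ∧
    (∀ k, IsReduced H (repeatList (c.map Letter.val) k)) ∧
    g = p.prod * lettersEval c * p.prod⁻¹

theorem lettersLen_append (l l' : List (Letter G)) :
    lettersLen (l ++ l') = lettersLen l + lettersLen l' := by simp [lettersLen]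

/-- The first and last letters are compared. With different labels the list is already cyclically
reduced. With equal labels, conjugating by the first letter moves it to the end, where it merges
with the last letter or cancels it; after a cancellation the argument recurses on the middle. -/
theorem exists_conj_of_reduced (m : ℕ) {l : List (Letter G)} (hm : l.length ≤ m)
    (hl : IsReduced H (l.map Letter.val)) (hS : ∀ p ∈ l, ∀ g ∈ p.2, g ∈ S p.1) :
    lettersEval l = 1 ∨ IsSimpleConj S (lettersLen l) (lettersEval l) ∨
      IsCyclicConj H S (lettersLen l) (lettersEval l) := by
  induction m generalizing l with
  | zero =>
    obtain rfl : l = [] := List.length_eq_zero_iff.1 (Nat.le_zero.1 hm)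
    exact .inl rfl
  | succ m ih =>
    rcases l with _ | ⟨g, l⟩
    · exact .inl rfl
    rcases List.eq_nil_or_concat l with rfl | ⟨mid, h, rfl⟩
    · refine .inr (.inl ⟨[], g.1, g.2, by simp, by simp, ?_, hS g (by simp), by simp [lettersLen],
        by simp⟩)
      intro h0
      exact (hl.2 g.val (by simp)).2 (by simp [Letter.val, h0])
    rw [List.concat_eq_append] at *
    have hlm : lettersLen (g :: (mid ++ [h])) = g.2.length + (lettersLen mid + h.2.length) := by
      simp [lettersLen]
    by_cases hgh : g.1 = h.1
    · have hl' : IsReduced H (mid.map Letter.val ++ [h.val]) :=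
        IsReduced.right (l := [g.val]) (by simpa using hl)
      have hgr : IsReduced H [g.val] := IsReduced.left (l' := mid.map Letter.val ++ [h.val])
        (by simpa using hl)
      have hgS : ∀ a ∈ g.2, ∃ j, a ∈ S j := fun a ha => ⟨_, hS g (by simp) a ha⟩
      by_cases h1 : h.2.prod * g.2.prod = 1
      · have e : lettersEval (g :: (mid ++ [h])) =
            g.2.prod * lettersEval mid * g.2.prod⁻¹ := by
          rw [← eq_inv_of_mul_eq_one_left h1]
          simp [mul_assoc]
        have hlen : mid.length ≤ m := by
          simp only [List.length_cons, List.length_append] at hm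
          lia
        rw [e, hlm]
        rcases ih hlen hl'.left (fun p hp => hS p (by simp [hp])) with h2 | h2 | h2
        · exact .inl (by simp [h2])
        · obtain ⟨p, j, w, hp, hpl, hw, hwS, hwl, he⟩ := h2
          refine .inr (.inl ⟨g.2 ++ p, j, w, ?_, ?_, hw, hwS, by lia, ?_⟩)
          · intro a ha
            exact (List.mem_append.1 ha).elim (hgS a) (hp a)
          · rw [List.length_append]
            lia
          · rw [he, List.prod_append]
            group
        · obtain ⟨p, c, hp, hpl, hc, hcS, hcl, hcr, he⟩ := h2
          refine .inr (.inr ⟨g.2 ++ p, c, ?_, ?_, hc, hcS, by lia, hcr, ?_⟩)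
          · intro a ha
            exact (List.mem_append.1 ha).elim (hgS a) (hp a)
          · rw [List.length_append]
            lia
          · rw [he, List.prod_append]
            group
      · refine .inr (.inr ⟨g.2, mid ++ [(h.1, h.2 ++ g.2)], hgS, by lia, by simp, ?_, ?_, ?_, ?_⟩)
        · intro p hp
          rcases List.mem_append.1 hp with hp | hp
          · exact hS p (by simp [hp])
          · rw [List.mem_singleton.1 hp]
            intro a ha
            rcases List.mem_append.1 ha with ha | ha
            · exact hS h (by simp) a ha
            · rw [← hgh]
              exact hS g (by simp) a ha
        · rw [lettersLen_append, hlm]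
          simp [lettersLen]
          lia
        · refine isReduced_repeatList ?_ ?_
          · have := hl'.merge (Y := []) hgr hgh.symm h1
            simpa [Letter.val] using this
          · intro a ha b hb
            have : a.1 = h.1 := by
              simp only [List.map_append, List.map_cons, List.map_nil, List.getLast?_append,
                List.getLast?_singleton, Option.some_or, Option.mem_def, Option.some.injEq] at ha
              rw [← ha]
              rfl
            rw [this, ← hgh]
            rcases mid with _ | ⟨c, mid⟩
            · have h2 := hl.1
              -- An empty middle is impossible, as the two letters would be adjacent with the same
              -- label.
              simp [Letter.val, hgh] at h2
            · have h2 := hl.1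
              simp only [List.map_cons, List.cons_append, List.isChain_cons_cons] at h2
              simp only [List.cons_append, List.map_cons, List.head?_cons, Option.mem_def,
                Option.some.injEq] at hb
              rw [← hb]
              exact h2.1
        · simp [mul_assoc]
    · refine .inr (.inr ⟨[], g :: (mid ++ [h]), by simp, by simp, by simp, hS, le_rfl, ?_, by simp⟩)
      refine isReduced_repeatList hl ?_
      intro a ha b hb
      have e : (g :: (mid ++ [h])).map Letter.val = (g :: mid).map Letter.val ++ [h.val] := by simp
      rw [e, List.getLast?_append] at ha
      simp only [List.getLast?_singleton, Option.some_or, Option.mem_def, Option.some.injEq] at ha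
      simp only [List.map_cons, List.head?_cons, Option.mem_def, Option.some.injEq] at hb
      rw [← ha, ← hb]
      exact fun h => hgh h.symm

/-- The trivial element counts as simple, which takes a nonempty word for `1` that is no longer than
`w`: `w` itself if it has length one, and `a a⁻¹` otherwise. -/
theorem isSimpleConj_or_isCyclicConj (hS : ∀ j, ∀ g ∈ S j, g ∈ H j)
    (hinv : ∀ j, ∀ g ∈ S j, g⁻¹ ∈ S j) {w : List G} (hw : ∀ g ∈ w, ∃ j, g ∈ S j) (hne : w ≠ []) :
    IsSimpleConj S w.length w.prod ∨ IsCyclicConj H S w.length w.prod := by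
  obtain ⟨l, h1, h2, h3, h4⟩ := exists_reduced_letters hS hw
  rcases exists_conj_of_reduced l.length le_rfl h1 h2 with h | h | h
  · left
    rw [h3] at h
    rcases w with _ | ⟨a, _ | ⟨b, w⟩⟩
    · exact (hne rfl).elim
    · obtain ⟨j, hj⟩ := hw a (by simp)
      exact ⟨[], j, [a], by simp, by simp, by simp, by simpa using hj, le_rfl, by simp⟩
    · obtain ⟨j, hj⟩ := hw a (by simp)
      exact ⟨[], j, [a, a⁻¹], by simp, by simp, by simp, by simp [hj, hinv j a hj], by simp,
        by rw [h]; simp⟩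
  · obtain ⟨p, j, w', hp, hpl, hw', hwS, hwl, he⟩ := h
    rw [h3] at he
    exact .inl ⟨p, j, w', hp, hpl.trans h4, hw', hwS, hwl.trans h4, he⟩
  · obtain ⟨p, c, hp, hpl, hc, hcS, hcl, hcr, he⟩ := h
    rw [h3] at he
    exact .inr ⟨p, c, hp, hpl.trans h4, hc, hcS, hcl.trans h4, hcr, he⟩

/-- A nontrivial letter needs at least one generator. This bounds the number of letters of a
cyclically reduced base by `N`. -/
theorem length_le_lettersLen_of_reduced {l : List (Letter G)}
    (h : ∀ a ∈ l.map Letter.val, a.2 ≠ 1) : l.length ≤ lettersLen l := by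
  induction l with
  | nil => simp
  | cons p l ih =>
    have h1 := ih fun a ha => h a (by simp only [List.map_cons, List.mem_cons]; exact .inr ha)
    have h2 : 1 ≤ p.2.length := by
      rw [Nat.one_le_iff_ne_zero, Ne, List.length_eq_zero_iff]
      intro h0
      exact h p.val (by simp) (by simp [Letter.val, h0])
    simp only [lettersLen, List.map_cons, List.sum_cons, List.length_cons] at h1 ⊢
    lia

end CyclicReduction

/-! ### Translation of the factors of an expression into items -/

section Sources

variable {G : Type*} [Group G] {V : Type*} {H : Bool → Subgroup G} {S : Bool → Set G} {C : Set V}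
  {N : ℕ}

theorem exists_items_of_word (H : Bool → Subgroup G) (C : Set V) (N : ℕ) {w : List G}
    (hw : ∀ g ∈ w, ∃ j, g ∈ S j) :
    ∃ L : List (Item V G), (∀ i ∈ L, i.OK H S C N) ∧ itemsVars L = 0 ∧ inputWt L = w.length ∧
      inputPot N L = w.length * (2 * N + 4) ∧ ∀ y, inputEval L y = w.prod := by
  induction w with
  | nil => exact ⟨[], by simp⟩
  | cons g w ih =>
    obtain ⟨L, h1, h2, h3, h4, h5⟩ := ih fun g hg => hw g (List.mem_cons_of_mem _ hg)
    obtain ⟨j, hj⟩ := hw g List.mem_cons_self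
    refine ⟨Letter.toItem (j, [g]) :: L, ?_, by simp [h2], by simp [h3, add_comm], ?_,
      by simp [h5]⟩
    · intro i hi
      rcases List.mem_cons.1 hi with rfl | hi
      · exact Letter.ok_toItem (by simpa using hj)
      · exact h1 i hi
    · rw [inputPot_cons, h4, inputPot_toItem, List.length_cons]
      ring

/-- The items for a factor `u ^ x * v` of a knapsack expression. -/
theorem exists_items_of_factor (hS : ∀ j, ∀ g ∈ S j, g ∈ H j)
    (hinv : ∀ j, ∀ g ∈ S j, g⁻¹ ∈ S j) {u v : List G} (hu : ∀ g ∈ u, ∃ j, g ∈ S j)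
    (hne : u ≠ []) (hv : ∀ g ∈ v, ∃ j, g ∈ S j) (hN : u.length ≤ N) {x : V}
    (hx : x ∈ C ↔ ¬ IsSimpleConj S u.length u.prod) :
    ∃ L : List (Item V G), (∀ i ∈ L, i.OK H S C N) ∧ itemsVars L = {x} ∧
      inputWt L ≤ 3 * u.length + v.length ∧
      inputPot N L ≤ (2 * u.length + v.length) * (2 * N + 4) + (10 * N ^ 2 + 6 * N + 7) ∧
      ∀ y, inputEval L y = u.prod ^ y x * v.prod := by
  obtain ⟨Lv, hv1, hv2, hv3, hv4, hv5⟩ := exists_items_of_word H C N hv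
  -- Both kinds of base give `u ^ x = p · i · p⁻¹` for a single item `i`. The weights of `p`, `i`
  -- and `p⁻¹` account for `3 |u|`; only the constants `p`, `p⁻¹` and `v` are cut into one-generator
  -- syllables.
  have key : ∀ (p : List G) (i : Item V G), (∀ a ∈ p, ∃ j, a ∈ S j) → p.length ≤ u.length →
      i.OK H S C N → i.vars = {x} → i.wt ≤ u.length → i.inputPot N ≤ 10 * N ^ 2 + 6 * N + 7 →
      (∀ y, p.prod * i.eval y * p.prod⁻¹ = u.prod ^ y x) →
      ∃ L : List (Item V G), (∀ i ∈ L, i.OK H S C N) ∧ itemsVars L = {x} ∧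
        inputWt L ≤ 3 * u.length + v.length ∧
        inputPot N L ≤ (2 * u.length + v.length) * (2 * N + 4) + (10 * N ^ 2 + 6 * N + 7) ∧
        ∀ y, inputEval L y = u.prod ^ y x * v.prod := by
    intro p i hp hpl hi hix hiw hip hie
    obtain ⟨Lp, hp1, hp2, hp3, hp4, hp5⟩ := exists_items_of_word H C N hp
    obtain ⟨Lq, hq1, hq2, hq3, hq4, hq5⟩ := exists_items_of_word (S := S) H C N
      (w := (p.map fun g => g⁻¹).reverse) (by
        intro g hg
        simp only [List.mem_reverse, List.mem_map] at hg
        obtain ⟨a, ha, rfl⟩ := hg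
        obtain ⟨j, hj⟩ := hp a ha
        exact ⟨j, hinv j a hj⟩)
    rw [← List.prod_inv_reverse] at hq5
    rw [List.length_reverse, List.length_map] at hq3 hq4
    refine ⟨Lp ++ i :: (Lq ++ Lv), ?_, by simp [hp2, hq2, hv2, hix], ?_, ?_, ?_⟩
    · intro k hk
      simp only [List.mem_append, List.mem_cons] at hk
      rcases hk with hk | rfl | hk | hk
      exacts [hp1 k hk, hi, hq1 k hk, hv1 k hk]
    · simp only [inputWt_append, inputWt_cons, hp3, hq3, hv3]
      lia
    · simp only [inputPot_append, inputPot_cons, hp4, hq4, hv4, add_mul, two_mul]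
      have := Nat.mul_le_mul_right (N + N + 4) hpl
      simp only [mul_add] at *
      lia
    · intro y
      rw [← hie]
      simp [hp5, hq5, hv5, mul_assoc]
  by_cases hs : IsSimpleConj S u.length u.prod
  · have hx' : x ∉ C := fun h => hx.1 h hs
    obtain ⟨p, j, w, hp, hpl, hw, hwS, hwl, he⟩ := hs
    refine key p (.syl j [(some x, w)]) hp hpl ?_ (by simp [Item.vars, fragVars])
      (by simpa [Item.wt, fragLen] using hwl) ?_ ?_
    · intro a ha
      rw [List.mem_singleton.1 ha]
      refine ⟨hwS, fun z hz => ?_⟩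
      obtain rfl : x = z := by simpa using hz
      exact ⟨hx', hw⟩
    · simp only [Item.inputPot]
      lia
    · intro y
      rw [he, conj_pow]
      simp [Item.eval, fragEval, Atom.eval]
  · obtain ⟨p, c, hp, hpl, hc, hcS, hcl, hcr, he⟩ :=
      (isSimpleConj_or_isCyclicConj hS hinv hu hne).resolve_left hs
    refine key p (.cpow x c) hp hpl ⟨hx.2 hs, hc, ?_, hcS, hcr⟩ rfl hcl le_rfl ?_
    · have h1 := hcr 1
      rw [repeatList_succ, repeatList_zero, List.append_nil] at h1
      exact (length_le_lettersLen_of_reduced fun a ha => (h1.2 a ha).2).trans (hcl.trans hN)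
    · intro y
      rw [he, conj_pow]
      rfl

end Sources

/-! ### The two factors form a free pair -/

section FreeProduct

universe v₁ v₂

/-- The two factors of a free product, in a common universe. -/
def Factor (G₁ : Type v₁) (G₂ : Type v₂) : Bool → Type (max v₁ v₂)
  | true => ULift.{v₂} G₁
  | false => ULift.{v₁} G₂

instance (G₁ : Type v₁) (G₂ : Type v₂) [Group G₁] [Group G₂] : ∀ b, Group (Factor G₁ G₂ b)
  | true => inferInstanceAs (Group (ULift G₁))
  | false => inferInstanceAs (Group (ULift G₂))

variable (G₁ : Type v₁) (G₂ : Type v₂) [Group G₁] [Group G₂]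

/-- The comparison map from the binary free product to the indexed one. -/
noncomputable def toCoprodI : Monoid.Coprod G₁ G₂ →* Monoid.CoprodI (Factor G₁ G₂) :=
  Monoid.Coprod.lift
    ((Monoid.CoprodI.of (M := Factor G₁ G₂) (i := true)).comp
      (MulEquiv.ulift.symm.toMonoidHom : G₁ →* ULift.{v₂} G₁))
    ((Monoid.CoprodI.of (M := Factor G₁ G₂) (i := false)).comp
      (MulEquiv.ulift.symm.toMonoidHom : G₂ →* ULift.{v₁} G₂))

/-- The images of the two factors in the free product. -/
def factorRange : Bool → Subgroup (Monoid.Coprod G₁ G₂)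
  | true => (Monoid.Coprod.inl : G₁ →* Monoid.Coprod G₁ G₂).range
  | false => (Monoid.Coprod.inr : G₂ →* Monoid.Coprod G₁ G₂).range

theorem exists_toCoprodI_eq (b : Bool) (g : Monoid.Coprod G₁ G₂) (hg : g ∈ factorRange G₁ G₂ b) :
    ∃ m : Factor G₁ G₂ b, toCoprodI G₁ G₂ g = Monoid.CoprodI.of m ∧ (m = 1 → g = 1) := by
  cases b with
  | true =>
    obtain ⟨a, rfl⟩ := hg
    refine ⟨(ULift.up a : ULift G₁), by simp [toCoprodI]; rfl, fun h => ?_⟩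
    rw [show a = 1 from congrArg ULift.down (show (ULift.up a : ULift G₁) = 1 from h), map_one]
  | false =>
    obtain ⟨a, rfl⟩ := hg
    refine ⟨(ULift.up a : ULift G₂), by simp [toCoprodI]; rfl, fun h => ?_⟩
    rw [show a = 1 from congrArg ULift.down (show (ULift.up a : ULift G₂) = 1 from h), map_one]

/-- A reduced list maps to a `Monoid.CoprodI.Word` with the same sequence of labels, and normal
forms in the indexed free product are unique. -/
theorem isFreePair_factorRange : IsFreePair (factorRange G₁ G₂) := by
  classical
  intro l hl h1
  choose f hf hf1 using exists_toCoprodI_eq G₁ G₂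
  let F : Bool × Monoid.Coprod G₁ G₂ → Σ b, Factor G₁ G₂ b := fun a =>
    ⟨a.1, if h : a.2 ∈ factorRange G₁ G₂ a.1 then f a.1 a.2 h else 1⟩
  have hF : ∀ a ∈ l, toCoprodI G₁ G₂ a.2 = Monoid.CoprodI.of (F a).2 ∧ (F a).2 ≠ 1 := by
    intro a ha
    obtain ⟨hm, hne⟩ := hl.2 a ha
    simp only [F, dif_pos hm]
    exact ⟨hf _ _ _, fun h => hne (hf1 _ _ _ h)⟩
  let w : Monoid.CoprodI.Word (Factor G₁ G₂) :=
    { toList := l.map F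
      ne_one := by
        intro s hs
        obtain ⟨a, ha, rfl⟩ := List.mem_map.1 hs
        exact (hF a ha).2
      chain_ne := (List.isChain_map F).2 hl.1 }
  have hw : w.prod = 1 := by
    rw [← map_one (toCoprodI G₁ G₂), ← h1, labelProd, map_list_prod, Monoid.CoprodI.Word.prod,
      List.map_map, List.map_map]
    congr 1
    exact List.map_congr_left fun a ha => (hF a ha).1.symm
  have hw' : w = Monoid.CoprodI.Word.empty :=
    (Monoid.CoprodI.Word.equiv (M := Factor G₁ G₂)).symm.injective
      (hw.trans Monoid.CoprodI.Word.prod_empty.symm)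
  have := congrArg Monoid.CoprodI.Word.toList hw'
  exact List.map_eq_nil_iff.1 this

end FreeProduct

/-! ### From certificates to a semilinear representation -/

section Semilinear

/-- A set is semilinear with small magnitude as soon as each of its elements lies in a linear
subset of small norm. -/
theorem exists_rep_of_cert {d : ℕ} {C : Set (Fin d)} {κ ρ μ B : ℕ} {X : Multiset (Fin d)}
    (hX : ∀ i, i ∈ X) {T : Set (Fin d → ℕ)} (hκ : κ ≤ B) (hρ : ρ ≤ B) (hμ : μ ≤ B)
    (h : ∀ τ ∈ T, Cert C κ ρ μ X τ fun y => y ∈ T) :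
    ∃ R : SemilinearRep d, R.toSet = T ∧ R.norm ≤ B := by
  classical
  have hfin : {p : Fin d → ℕ | ∀ i, p i ≤ B}.Finite :=
    Set.Finite.pi' fun _ => Set.finite_Iic B
  -- All pairs of a base and a period set with entries at most `B` whose linear set lies in `T` are
  -- taken at once. There are finitely many, and the certificates say that they cover `T`.
  have hfin' : {q : (Fin d → ℕ) × Set (Fin d → ℕ) | ((∀ i, q.1 i ≤ B) ∧ ∀ p ∈ q.2, ∀ i, p i ≤ B) ∧
      ∀ p ∈ AddSubmonoid.closure q.2, q.1 + p ∈ T}.Finite :=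
    (hfin.prod hfin.finite_subsets).subset fun q hq => ⟨hq.1.1, hq.1.2⟩
  have hlin : ∀ q ∈ hfin'.toFinset, ∃ L : LinearRep d, L.norm ≤ B ∧
      ∀ y, y ∈ L.toSet ↔ ∃ p ∈ AddSubmonoid.closure q.2, q.1 + p = y := by
    rintro ⟨b, P⟩ hq
    rw [Set.Finite.mem_toFinset] at hq
    have hP : P.Finite := hfin.subset hq.1.2
    obtain ⟨k, f, hf⟩ : ∃ (k : ℕ) (f : Fin k → (Fin d → ℕ)), Set.range f = P := by
      obtain ⟨k, f, -, hf⟩ := hP.fin_param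
      exact ⟨k, f, hf⟩
    refine ⟨⟨b, k, Matrix.of fun i j => f j i⟩, ?_, fun y => ?_⟩
    · refine max_le (Finset.sup_le fun i _ => hq.1.1 i)
        (Finset.sup_le fun i _ => Finset.sup_le fun j _ => hq.1.2 (f j) ?_ i)
      rw [← hf]
      exact ⟨j, rfl⟩
    · rw [LinearRep.toSet_eq_vadd, Set.mem_vadd_set]
      subst hf
      rfl
  have : Nonempty (LinearRep d) := ⟨⟨0, 0, 0⟩⟩
  choose! L hL1 hL2 using hlin
  refine ⟨hfin'.toFinset.toList.map L, ?_, ?_⟩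
  · ext y
    constructor
    · rintro ⟨L', hL', hy⟩
      obtain ⟨q, hq, rfl⟩ := List.mem_map.1 hL'
      rw [Finset.mem_toList] at hq
      obtain ⟨p, hp, rfl⟩ := (hL2 q hq y).1 hy
      exact ((Set.Finite.mem_toFinset _).1 hq).2 p hp
    · intro hy
      obtain ⟨b, P, -, -, hb1, hb2, hP, ⟨p, hp, hyp⟩, hsol⟩ := h y hy
      have hq : (b, P) ∈ hfin'.toFinset := by
        rw [Set.Finite.mem_toFinset]
        refine ⟨⟨fun i => ?_, fun p hp i => (hP p hp i).trans hρ⟩, fun p hp =>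
          hsol _ p hp fun _ _ => rfl⟩
        by_cases hi : i ∈ C
        · exact (hb2 i hi).trans hμ
        · exact (hb1 i hi).trans hκ
      refine ⟨L (b, P), List.mem_map.2 ⟨_, Finset.mem_toList.2 hq, rfl⟩, (hL2 _ hq y).2 ⟨p, hp, ?_⟩⟩
      ext i
      exact (hyp i (hX i)).symm
  · have : ∀ R : SemilinearRep d, (∀ L ∈ R, L.norm ≤ B) → R.norm ≤ B := by
      intro R hR
      induction R with
      | nil => exact Nat.zero_le _
      | cons L R ih =>
        exact max_le (hR L List.mem_cons_self) (ih fun L' hL' => hR L' (List.mem_cons_of_mem _ hL'))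
    refine this _ fun L' hL' => ?_
    obtain ⟨q, hq, rfl⟩ := List.mem_map.1 hL'
    exact hL1 q (Finset.mem_toList.1 hq)

end Semilinear

/-! ### The bound for free products -/

section Main

universe v₁ v₂

variable {G₁ : Type v₁} {G₂ : Type v₂} [Group G₁] [Group G₂]

/-- The generating sets of the two factors, inside the free product. -/
def factorGens (S₁ : Set G₁) (S₂ : Set G₂) : Bool → Set (Monoid.Coprod G₁ G₂)
  | true => Monoid.Coprod.inl '' S₁
  | false => Monoid.Coprod.inr '' S₂

theorem length_pos_of_expr {A : Type*} (e : Expr A) (i : Fin e.deg) : 1 ≤ (e.period i).length :=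
  List.length_pos_iff.2 (e.period_ne_nil i)

theorem inputEval_flatten {G V : Type*} [Group G] (L : List (List (Item V G))) (y : V → ℕ) :
    inputEval L.flatten y = (L.map fun l => inputEval l y).prod := by
  induction L with
  | nil => rfl
  | cons l L ih => simp [ih]

theorem itemsVars_flatten {G V : Type*} [Group G] (L : List (List (Item V G))) :
    itemsVars L.flatten = (L.map itemsVars).sum := by
  induction L with
  | nil => rfl
  | cons l L ih => simp [ih]

theorem inputWt_flatten {G V : Type*} [Group G] (L : List (List (Item V G))) :
    inputWt L.flatten = (L.map inputWt).sum := by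
  induction L with
  | nil => rfl
  | cons l L ih => simp [ih]

theorem inputPot_flatten {G V : Type*} [Group G] (N : ℕ) (L : List (List (Item V G))) :
    inputPot N L.flatten = (L.map (inputPot N)).sum := by
  induction L with
  | nil => rfl
  | cons l L ih => simp [ih]

/-- The machine runs with `N = n` and `W = 6 * m * n`. One representation yields both the
semilinearity of the solution set and the bound on its magnitude. -/
theorem exists_rep_freeProduct {S₁ : Set G₁} {S₂ : Set G₂} (h₁ : IsFiniteSymmGenSet S₁)
    (h₂ : IsFiniteSymmGenSet S₂) (hs₁ : IsKnapsackSemilinear S₁) (hs₂ : IsKnapsackSemilinear S₂)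
    (e : Expr (freeProductGens S₁ S₂)) {n m : ℕ} (hn : e.length ≤ n) (hm : e.deg ≤ m) :
    ∃ R : SemilinearRep e.deg, R.toSet = e.sol ∧
      R.norm ≤ max (max (K S₁ (6 * m * n) m) (K S₂ (6 * m * n) m)) (100 * (m * n ^ 4)) := by
  classical
  set κ := max (K S₁ (6 * m * n) m) (K S₂ (6 * m * n) m) with hκ
  set S := factorGens S₁ S₂
  set H := factorRange G₁ G₂
  have hSH : ∀ j, ∀ g ∈ S j, g ∈ H j := by
    rintro (_ | _) _ ⟨g, -, rfl⟩ <;> exact ⟨g, rfl⟩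
  have hinv : ∀ j, ∀ g ∈ S j, g⁻¹ ∈ S j := by
    rintro (_ | _) _ ⟨g, hg, rfl⟩
    · exact ⟨g⁻¹, h₂.inv_mem g hg, map_inv _ _⟩
    · exact ⟨g⁻¹, h₁.inv_mem g hg, map_inv _ _⟩
  have hword : ∀ w : List (freeProductGens S₁ S₂), ∀ g ∈ w.map Subtype.val, ∃ j, g ∈ S j := by
    intro w g hg
    obtain ⟨a, -, rfl⟩ := List.mem_map.1 hg
    rcases a.2 with h | h
    · exact ⟨true, h⟩
    · exact ⟨false, h⟩
  let U : Fin e.deg → List (Monoid.Coprod G₁ G₂) := fun i => (e.period i).map Subtype.val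
  let C : Set (Fin e.deg) := {i | ¬ IsSimpleConj S (U i).length (U i).prod}
  have hlen : ∀ i, (U i).length ≤ n := by
    intro i
    refine le_trans ?_ hn
    rw [List.length_map]
    exact (Nat.le_add_right _ _).trans (Finset.single_le_sum
      (f := fun i => (e.period i).length + (e.const i).length)
      (fun _ _ => Nat.zero_le _) (Finset.mem_univ i))
  have hm1 : 1 ≤ m := e.deg_pos.trans hm
  have hn1 : 1 ≤ n := (length_pos_of_expr e ⟨0, e.deg_pos⟩).trans (by
    simpa [U] using hlen ⟨0, e.deg_pos⟩)
  -- Periods have two sources: factor certificates, with entries at most `κ`, and pumped pairs of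
  -- powers, with entries at most `n`.
  have hM : Machine (V := Fin e.deg) H S C n (6 * m * n) κ (max κ n) := by
    refine ⟨isFreePair_factorRange G₁ G₂, hSH, le_max_right _ _, ?_⟩
    rintro (_ | _) F τ hF hW hnd hτ
    · exact cert_of_frag (T := S₂) (φ := (Monoid.Coprod.inr : G₂ →* Monoid.Coprod G₁ G₂))
        h₂.finite hs₂ Monoid.Coprod.inr_injective (by simpa using hm) (le_max_right _ _)
        ((le_max_right _ _).trans (le_max_left _ _)) hF hW hnd hτ
    · exact cert_of_frag (T := S₁) (φ := (Monoid.Coprod.inl : G₁ →* Monoid.Coprod G₁ G₂))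
        h₁.finite hs₁ Monoid.Coprod.inl_injective (by simpa using hm) (le_max_left _ _)
        ((le_max_left _ _).trans (le_max_left _ _)) hF hW hnd hτ
  choose L hL1 hL2 hL3 hL4 hL5 using fun i => exists_items_of_factor (H := H) (C := C) (N := n) hSH
    hinv (hword (e.period i)) (fun h => e.period_ne_nil i (List.map_eq_nil_iff.1 h)) (hword (e.const i)) (hlen i)
    (x := i) Iff.rfl
  set inp := (List.ofFn L).flatten with hinp
  have hvars : itemsVars inp = (Finset.univ : Finset (Fin e.deg)).val := by
    rw [hinp, itemsVars_flatten, List.map_ofFn, List.sum_ofFn]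
    simp only [Function.comp_apply, hL2]
    exact Finset.sum_multiset_singleton _
  have hsum : ∑ i, (U i).length + ∑ i, (e.const i).length ≤ n := by
    rw [← Finset.sum_add_distrib]
    refine le_trans (le_of_eq ?_) hn
    simp [U, Expr.length]
  -- Conjugation at most triples the lengths of the bases, so the weight is already at most `3 * n`.
  have hwt : inputWt inp ≤ 6 * m * n := by
    rw [hinp, inputWt_flatten, List.map_ofFn, List.sum_ofFn]
    calc ∑ i, inputWt (L i) ≤ ∑ i, (3 * (U i).length + (e.const i).length) :=
          Finset.sum_le_sum fun i _ => (hL3 i).trans (by simp [U])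
      _ = 3 * ∑ i, (U i).length + ∑ i, (e.const i).length := by
          rw [Finset.sum_add_distrib, Finset.mul_sum]
      _ ≤ 6 * 1 * n := by lia
      _ ≤ 6 * m * n := Nat.mul_le_mul_right _ (Nat.mul_le_mul_left _ hm1)
  -- At most `2 * n` constant generators contribute `2 * n + 4` each, and at most `m` items carrying
  -- variables contribute `10 * n ^ 2 + 6 * n + 7` each.
  have hpot : inputPot n inp ≤ 100 * (m * n ^ 4) := by
    have hn4 : n ≤ m * n ^ 4 ∧ n ^ 2 ≤ m * n ^ 4 ∧ m ≤ m * n ^ 4 ∧ m * n ≤ m * n ^ 4 ∧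
        m * n ^ 2 ≤ m * n ^ 4 := by
      have h1 : n ≤ n ^ 4 := Nat.le_self_pow (by norm_num) n
      have h2 : n ^ 2 ≤ n ^ 4 := Nat.pow_le_pow_right hn1 (by norm_num)
      have h3 : n ^ 4 ≤ m * n ^ 4 := Nat.le_mul_of_pos_left _ hm1
      exact ⟨h1.trans h3, h2.trans h3, Nat.le_mul_of_pos_right _ (hn1.trans h1),
        Nat.mul_le_mul_left _ h1, Nat.mul_le_mul_left _ h2⟩
    rw [hinp, inputPot_flatten, List.map_ofFn, List.sum_ofFn]
    calc ∑ i, inputPot n (L i) ≤ ∑ i, ((2 * (U i).length + (e.const i).length) * (2 * n + 4) +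
            (10 * n ^ 2 + 6 * n + 7)) :=
          Finset.sum_le_sum fun i _ => (hL4 i).trans (by simp [U])
      _ = (2 * ∑ i, (U i).length + ∑ i, (e.const i).length) * (2 * n + 4) +
            e.deg * (10 * n ^ 2 + 6 * n + 7) := by
          rw [Finset.sum_add_distrib, ← Finset.sum_mul, Finset.sum_add_distrib, Finset.mul_sum]
          simp
      _ ≤ (2 * n) * (2 * n + 4) + m * (10 * n ^ 2 + 6 * n + 7) :=
          Nat.add_le_add (Nat.mul_le_mul_right _ (by lia)) (Nat.mul_le_mul_right _ hm)
      _ = 4 * n ^ 2 + 8 * n + (10 * (m * n ^ 2) + 6 * (m * n) + 7 * m) := by ring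
      _ ≤ 100 * (m * n ^ 4) := by lia
  have hn4 : n ≤ 100 * (m * n ^ 4) := by
    have h1 : n ≤ n ^ 4 := Nat.le_self_pow (by norm_num) n
    have h3 : n ^ 4 ≤ m * n ^ 4 := Nat.le_mul_of_pos_left _ hm1
    lia
  have hval : ∀ y, inputEval inp y = 1 ↔ y ∈ e.sol := by
    intro y
    change _ ↔ evalWord (e.valuate y) = 1
    rw [evalWord_valuate, hinp, inputEval_flatten, List.map_ofFn]
    simp only [Function.comp_def, hL5, evalWord_eq]
  refine exists_rep_of_cert (C := C) (κ := κ) (ρ := max κ n) (μ := inputPot n inp)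
    (X := itemsVars inp) (by simp [hvars]) (le_max_left _ _)
    (max_le (le_max_left _ _) (hn4.trans (le_max_right _ _))) (hpot.trans (le_max_right _ _)) ?_
  intro τ hτ
  refine (cert_of_items hM ?_ hwt ?_ ((hval τ).2 hτ)).congr (fun _ => Iff.rfl) le_rfl
    fun y => (hval y).1
  · intro i hi
    obtain ⟨l, hl, hi⟩ := List.mem_flatten.1 hi
    obtain ⟨k, rfl⟩ := (List.mem_ofFn' L l).1 hl
    exact hL1 k i hi
  · rw [hvars]
    exact Finset.univ.nodup

theorem K_freeProduct_le {S₁ : Set G₁} {S₂ : Set G₂} (h₁ : IsFiniteSymmGenSet S₁)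
    (h₂ : IsFiniteSymmGenSet S₂) (hs₁ : IsKnapsackSemilinear S₁) (hs₂ : IsKnapsackSemilinear S₂)
    (n m : ℕ) : K (freeProductGens S₁ S₂) n m ≤
      max (max (K S₁ (6 * m * n) m) (K S₂ (6 * m * n) m)) (100 * (m * n ^ 4)) := by
  refine csSup_le' ?_
  rintro _ ⟨e, ⟨-, hn, hm⟩, rfl⟩
  obtain ⟨R, hR, hRn⟩ := exists_rep_freeProduct h₁ h₂ hs₁ hs₂ e hn hm
  refine (Nat.sInf_le ?_).trans hRn
  exact ⟨R, hR, rfl⟩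

/-- Coefficients in `ℕ` make evaluation monotone, so `6 * m * n` may be replaced by `6 * n ^ 2` in a
polynomial bound. -/
theorem eval_le_eval (p : Polynomial ℕ) {a b : ℕ} (h : a ≤ b) : p.eval a ≤ p.eval b := by
  rw [Polynomial.eval_eq_sum_range, Polynomial.eval_eq_sum_range]
  gcongr

end Main

end Knapsack

theorem mainTheorem5 :
    ∃ C : ℕ, ∀ (G₁ : Type*) (G₂ : Type*) [Group G₁] [Group G₂] (S₁ : Set G₁) (S₂ : Set G₂),
      Knapsack.IsFiniteSymmGenSet S₁ → Knapsack.IsFiniteSymmGenSet S₂ →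
      Knapsack.IsKnapsackSemilinear S₁ → Knapsack.IsKnapsackSemilinear S₂ →
        Knapsack.IsKnapsackSemilinear (Knapsack.freeProductGens S₁ S₂) ∧
        (∀ n m : ℕ, m ≤ n →
          Knapsack.K (Knapsack.freeProductGens S₁ S₂) n m ≤
            max (max (Knapsack.K S₁ (6 * m * n) m) (Knapsack.K S₂ (6 * m * n) m))
              (C * (m * n ^ 4))) ∧
        (Knapsack.PolyBounded (Knapsack.K S₁) → Knapsack.PolyBounded (Knapsack.K S₂) →
          Knapsack.PolyBounded (Knapsack.K (Knapsack.freeProductGens S₁ S₂))) := by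
  refine ⟨100, ?_⟩
  intro G₁ G₂ _ _ S₁ S₂ h₁ h₂ hs₁ hs₂
  refine ⟨fun e => ?_, fun n m _ => Knapsack.K_freeProduct_le h₁ h₂ hs₁ hs₂ n m, ?_⟩
  · obtain ⟨R, hR, -⟩ := Knapsack.exists_rep_freeProduct h₁ h₂ hs₁ hs₂ e le_rfl le_rfl
    exact (Knapsack.isSemilinearSet_iff_exists_rep _).2 ⟨R, hR⟩
  · rintro ⟨p, hp⟩ ⟨q, hq⟩
    -- The maximum is bounded by the sum, with `6 * m * n ≤ 6 * n ^ 2` and `m * n ^ 4 ≤ n ^ 5`.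
    refine ⟨p.comp (6 * Polynomial.X ^ 2) + q.comp (6 * Polynomial.X ^ 2) +
      100 * Polynomial.X ^ 5, fun n m hmn => ?_⟩
    -- The hypotheses bound `K` only on pairs `m ≤ n`, so the pair `(6 * m * n, m)` has to be
    -- checked; when `n = 0`, also `m = 0`.
    have hm : m ≤ 6 * m * n := by
      rcases Nat.eq_zero_or_pos n with rfl | hn
      · simpa using hmn
      · rw [mul_comm 6 m, mul_assoc]
        exact Nat.le_mul_of_pos_right _ (by lia)
    have hle : 6 * m * n ≤ 6 * n ^ 2 := by
      rw [pow_two, mul_assoc]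
      exact Nat.mul_le_mul_left _ (Nat.mul_le_mul_right _ hmn)
    have h5 : m * n ^ 4 ≤ n ^ 5 := by
      rw [pow_succ' n 4]
      exact Nat.mul_le_mul_right _ hmn
    have hp' := (hp _ m hm).trans (Knapsack.eval_le_eval p hle)
    have hq' := (hq _ m hm).trans (Knapsack.eval_le_eval q hle)
    refine (Knapsack.K_freeProduct_le h₁ h₂ hs₁ hs₂ n m).trans ?_
    simp only [Polynomial.eval_add, Polynomial.eval_comp, Polynomial.eval_mul,
      Polynomial.eval_pow, Polynomial.eval_X, Polynomial.eval_ofNat]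
    refine max_le (max_le ?_ ?_) ?_ <;> lia
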